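/- All trees are finite and rooted; $\emptyset$ denotes the root, a \emph{leaf} is a vertex without children, the other vertices are \emph{internal}, $\mathrm{Ch}(u)$ is the set of children of $u$, and $\mathcal{T}_u$ is the subtree of $\mathcal{T}$ made up of $u$ and its descendants, rooted at $u$. A homomorphism of rooted trees sends the root to the root, children of $u$ to children of the image of $u$, and leaves to leaves; for such a $\varphi\colon\mathcal{T}\to\mathcal{P}$ let $\varphi_u\colon\mathcal{T}_u\to\mathcal{P}_{\varphi(u)}$ be its restriction. $\mathrm{Aut}(\mathcal{T})$ is the group of automorphisms of $\mathcal{T}$ as a rooted tree. \textbf{Tree compositions.} $\mathsf{C}(\mathcal{T},\mathcal{P})$ is the set of the surjective homomorphisms $\varphi\colon\mathcal{T}\to\mathcal{P}$ such that, whenever $u\ne v$ are internal siblings with $\varphi(u)=\varphi(v)$, there is $\tau\in\mathrm{Aut}(\mathcal{T})$ with $\tau(u)=v$ and $\varphi_u=\varphi_v\circ\tau|_{\mathcal{T}_u}$. Two tree compositions $\varphi_j\colon\mathcal{T}_j\to\mathcal{P}_j$, $j=1,2$, are \emph{equivalent} if $\omega\circ\varphi_1=\varphi_2\circ\tau$ for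 some isomorphisms $\tau\colon\mathcal{T}_1\to\mathcal{T}_2$, $\omega\colon\mathcal{P}_1\to\mathcal{P}_2$; they are \emph{strictly equivalent} if this holds with $\mathcal{P}_1=\mathcal{P}_2$ and $\omega=\mathrm{id}$, and \emph{isomorphic} if it holds with $\mathcal{T}_1=\mathcal{T}_2$ and $\tau=\mathrm{id}$. For $g\in\mathrm{Aut}(\mathcal{T})$ let $\mathcal{P}^g$ be the tree of the $g$-orbits on the vertices of $\mathcal{T}$, where the orbit of a child of $u$ is a child of the orbit of $u$, and let $\varphi^g\in\mathsf{C}(\mathcal{T},\mathcal{P}^g)$ map each vertex to its $g$-orbit. \textbf{Trees of partitions.} A \emph{partitional labeling} $\Lambda$ of a tree $\mathcal{Q}$ assigns to each non-root vertex $a$ a partition $\lambda^a$ of a positive integer $|\lambda^a|$; an isomorphism of labelings is an isomorphism of the trees that preserves the labels. $(\Lambda,\mathcal{Q})$ is a \emph{tree of partitions} if among the children of each internal vertex at most one is a leaf, and if for distinct internal siblings $a,b$ the labelings $\Lambda_a,\Lambda_b$ obtained by restriction to $\mathcal{Q}_a,\mathcal{Q}_b$ (with unlabeled roots $a,b$)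 are not isomorphic. $\mathsf{Par}(\mathcal{T})$ is the set of the trees of partitions $(\Lambda,\mathcal{Q})$, up to isomorphism, for which there is $\delta\in\mathsf{C}(\mathcal{T},\mathcal{Q})$ such that $|\lambda^b|=|\delta^{-1}(b)\cap\mathrm{Ch}(u)|$ for all $u\in\mathcal{T}$ and all $b\in\mathrm{Ch}(\delta(u))$. \textbf{Association.} A \emph{quotient} of $\varphi\in\mathsf{C}(\mathcal{T},\mathcal{P})$ is an $\alpha\in\mathsf{C}(\mathcal{P},\mathcal{Q})$, for some tree $\mathcal{Q}$, such that: (1) if the set $Y$ of the children of $x\in\mathcal{P}$ that are leaves is not empty, then $\alpha(Y)$ is a singleton $\{a\}$ and $a$ is the unique child of $\alpha(x)$ that is a leaf; (2) if $a\neq b$ are internal siblings in $\mathcal{Q}$ and $u,v$ are siblings in $\mathcal{T}$ with $\alpha(\varphi(u))=a$, $\alpha(\varphi(v))=b$, then $\varphi_u$ and $\varphi_v$ are not equivalent; (3) if $u,v\in\mathcal{T}$ are internal and $\alpha(\varphi(u))=\alpha(\varphi(v))$, then $\varphi_u,\varphi_v$ are equivalent and the restrictions of $\alpha\circ\varphi$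 to $\mathcal{T}_u$ and $\mathcal{T}_v$ are strictly equivalent. The tree of partitions $(\Lambda,\mathcal{Q})$ is \emph{associated} to $\varphi$ if $\varphi$ has a quotient $\alpha\in\mathsf{C}(\mathcal{P},\mathcal{Q})$ such that, for every $u\in\mathcal{T}$ and every child $b$ of $\alpha(\varphi(u))$, the parts of $\lambda^b$ are the numbers $|\varphi^{-1}(y)\cap\mathrm{Ch}(u)|$, $y\in\mathrm{Ch}(\varphi(u))\cap\alpha^{-1}(b)$. \textbf{Statement.} Let $\mathcal{T}$ be a finite rooted tree. For every conjugacy class $C$ of $\mathrm{Aut}(\mathcal{T})$ the set $\{\varphi^g\colon g\in C\}$ is, up to isomorphism, an equivalence class of tree compositions of $\mathcal{T}$: for $g\in C$, a tree composition $\psi$ of $\mathcal{T}$ is equivalent to $\varphi^g$ if and only if it is isomorphic to $\varphi^{g'}$ for some $g'\in C$. Moreover there is a bijection from the set of conjugacy classes of $\mathrm{Aut}(\mathcal{T})$ onto $\mathsf{Par}(\mathcal{T})$ that sends each class $C$ to the tree of partitions associated to $\varphi^g$, for every $g\in C$; this tree of partitions exists and is unique up to isomorphism. -/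

import Mathlib

universe u v w

/-!
Rooted trees are Mathlib's `RootedTree`s: the vertices carry the ancestor order, the root is `⊥`,
`p ⋖ u` says that `p` is the parent of `u` (`u` is a child of `p`), a leaf is a maximal vertex, an
internal vertex is a vertex that is not maximal. The bijections that preserve adjacency and fix the
root are the order isomorphisms, so that `T ≃o T` is the automorphism group of `T`.
-/

namespace RootedTree

/-- The subtree `T_u` made up of `u` and all its descendants, with root `u`. -/
noncomputable abbrev below (T : RootedTree.{u}) (u : T) : RootedTree.{u} :=
  (T.subtree u).coeTree

/-- Two vertices with the same parent. -/
def Siblings {T : RootedTree.{u}} (u v : T) : Prop :=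
  ∃ p : T, p ⋖ u ∧ p ⋖ v

/-- A finite partial order with a least element, in which the elements below a given one form a
chain, is a rooted tree. -/
noncomputable def ofChains (α : Type u) [PartialOrder α] [OrderBot α] [Finite α]
    (hchain : ∀ a b c : α, a ≤ c → b ≤ c → a ≤ b ∨ b ≤ a) : RootedTree.{u} :=
  have hinf : ∀ a b : α, ∃ m : α, (m ≤ a ∧ m ≤ b) ∧ ∀ c, c ≤ a → c ≤ b → c ≤ m := by
    intro a b
    obtain ⟨m, hm⟩ := (Set.toFinite {c : α | c ≤ a ∧ c ≤ b}).exists_maximal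
      ⟨⊥, bot_le, bot_le⟩
    refine ⟨m, hm.1, fun c hca hcb => ?_⟩
    rcases hchain c m a hca hm.1.1 with h | h
    · exact h
    · exact hm.2 ⟨hca, hcb⟩ h
  have hpred : ∀ a : α, ∃ m : α, m ≤ a ∧ (a ≤ m → IsMin a) ∧ ∀ c, c < a → c ≤ m := by
    intro a
    by_cases ha : a = ⊥
    · subst ha
      exact ⟨⊥, le_rfl, fun _ => isMin_bot, fun c hc => hc.le⟩
    · obtain ⟨m, hm⟩ := (Set.toFinite {c : α | c < a}).exists_maximal
        ⟨⊥, bot_lt_iff_ne_bot.2 ha⟩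
      refine ⟨m, hm.1.le, fun h => absurd hm.1 (not_lt_of_ge h), fun c hc => ?_⟩
      rcases hchain c m a hc.le hm.1.le with h | h
      · exact h
      · exact hm.2 hc h
  letI sl : SemilatticeInf α :=
    { (inferInstance : PartialOrder α) with
      inf := fun a b => (hinf a b).choose
      inf_le_left := fun a b => (hinf a b).choose_spec.1.1
      inf_le_right := fun a b => (hinf a b).choose_spec.1.2
      le_inf := fun c a b hca hcb => (hinf a b).choose_spec.2 c hca hcb }
  letI po : PredOrder α :=
    { pred := fun a => (hpred a).choose
      pred_le := fun a => (hpred a).choose_spec.1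
      min_of_le_pred := fun {a} h => (hpred a).choose_spec.2.1 h
      le_pred_of_lt := fun {a b} h => (hpred b).choose_spec.2.2 a h }
  { α := α }

end RootedTree

/-- A homomorphism of rooted trees: it sends the root to the root, children of `u` to children of
the image of `u`, and leaves to leaves. -/
structure TreeHom (T : RootedTree.{u}) (P : RootedTree.{v}) where
  toFun : T → P
  map_root : toFun ⊥ = ⊥
  map_child : ∀ {p u : T}, p ⋖ u → toFun p ⋖ toFun u
  map_leaf : ∀ {u : T}, IsMax u → IsMax (toFun u)

namespace TreeHom

variable {T : RootedTree.{u}} {P : RootedTree.{v}}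

instance : CoeFun (TreeHom T P) (fun _ => T → P) := ⟨TreeHom.toFun⟩

theorem monotone (φ : TreeHom T P) : Monotone φ := by
  intro a b hab
  obtain ⟨n, hn⟩ := hab.exists_pred_iterate
  clear hab
  induction n generalizing a with
  | zero => simp only [Function.iterate_zero, id] at hn; rw [hn]
  | succ n ih =>
    rw [Function.iterate_succ_apply'] at hn
    refine le_trans ?_ (ih rfl)
    by_cases h : IsMin (Order.pred^[n] b)
    · rw [← hn, h.pred_eq]
    · have hc := Order.pred_covBy_of_not_isMin h
      rw [hn] at hc
      exact (φ.map_child hc).le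

theorem below_covBy_iff {T : RootedTree.{u}} {r : T} {a b : T.below r} :
    a ⋖ b ↔ a.1 ⋖ b.1 := by
  constructor
  · intro h
    refine ⟨h.1, fun c hac hcb => ?_⟩
    exact h.2 (c := ⟨c, le_trans a.2 hac.le⟩) hac hcb
  · intro h
    exact ⟨h.1, fun c hac hcb => h.2 hac hcb⟩

theorem below_isMax_iff {T : RootedTree.{u}} {r : T} {a : T.below r} :
    IsMax a ↔ IsMax a.1 := by
  constructor
  · intro h c hc
    exact h (b := ⟨c, le_trans a.2 hc⟩) hc
  · intro h c hc
    exact h hc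

/-- The restriction `φ_u : T_u → P_{φ(u)}`. -/
def restrict (φ : TreeHom T P) (u : T) : TreeHom (T.below u) (P.below (φ u)) where
  toFun w := ⟨φ w.1, φ.monotone w.2⟩
  map_root := rfl
  map_child h := below_covBy_iff.2 (φ.map_child (below_covBy_iff.1 h))
  map_leaf h := below_isMax_iff.2 (φ.map_leaf (below_isMax_iff.1 h))

/-- Equivalence: isomorphisms `τ` and `ω` with `ω ∘ φ₁ = φ₂ ∘ τ`. -/
def Equivalent {T₁ : RootedTree.{u}} {P₁ : RootedTree.{v}} {T₂ : RootedTree.{u}}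
    {P₂ : RootedTree.{v}} (φ₁ : TreeHom T₁ P₁) (φ₂ : TreeHom T₂ P₂) : Prop :=
  ∃ (τ : T₁ ≃o T₂) (ω : P₁ ≃o P₂), ∀ t : T₁, ω (φ₁ t) = φ₂ (τ t)

/-- Isomorphism: equivalence with `τ` the identity. -/
def Isomorphic {P₁ P₂ : RootedTree.{v}} (φ₁ : TreeHom T P₁) (φ₂ : TreeHom T P₂) : Prop :=
  ∃ ω : P₁ ≃o P₂, ∀ t : T, ω (φ₁ t) = φ₂ t

end TreeHom

/-- The `P`-compositions of `T`, i.e. the elements of `C(T, P)`: surjective homomorphisms that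
satisfy the regularity condition. -/
structure TreeComposition (T : RootedTree.{u}) (P : RootedTree.{v}) extends TreeHom T P where
  surjective : Function.Surjective toFun
  regular : ∀ u v : T, RootedTree.Siblings u v → u ≠ v → ¬ IsMax u → ¬ IsMax v →
    toFun u = toFun v →
    ∃ τ : T ≃o T, τ u = v ∧ ∀ t : T, u ≤ t → toFun t = toFun (τ t)

namespace TreeComposition

variable {T : RootedTree.{u}} {P : RootedTree.{v}} {Q : RootedTree.{w}}

instance : CoeFun (TreeComposition T P) (fun _ => T → P) := ⟨fun φ => φ.toFun⟩

/-- `α : P → Q` is the quotient of the tree composition `φ : T → P`. -/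
structure IsQuotient (φ : TreeComposition T P) (α : TreeComposition P Q) : Prop where
  /-- If the set `Y` of the children of `x` that are leaves is not empty, then `α` maps it to a
  singleton `{a}`, and `a` is the unique child of `α x` that is a leaf. -/
  leaves : ∀ x : P, {y : P | x ⋖ y ∧ IsMax y}.Nonempty →
    ∃ a : Q, α '' {y : P | x ⋖ y ∧ IsMax y} = {a} ∧ {b : Q | α x ⋖ b ∧ IsMax b} = {a}
  /-- Siblings with distinct internal images carry inequivalent compositions. -/
  inequivalent : ∀ a b : Q, RootedTree.Siblings a b → a ≠ b → ¬ IsMax a → ¬ IsMax b →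
    ∀ u v : T, RootedTree.Siblings u v → α (φ u) = a → α (φ v) = b →
      ¬ (φ.restrict u).Equivalent (φ.restrict v)
  /-- Internal vertices with the same image carry equivalent compositions. -/
  equivalent : ∀ u v : T, ¬ IsMax u → ¬ IsMax v → α (φ u) = α (φ v) →
    (φ.restrict u).Equivalent (φ.restrict v)
  /-- For internal vertices with the same image, the restrictions of `α ∘ φ` are strictly
  equivalent. -/
  strict : ∀ u v : T, ¬ IsMax u → ¬ IsMax v → α (φ u) = α (φ v) →
    ∃ τ : T.below u ≃o T.below v, ∀ t : T.below u, α (φ t.1) = α (φ (τ t).1)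

end TreeComposition

/-- Integer partitions of positive integers. -/
abbrev IntegerPartition : Type := Σ n : ℕ+, Nat.Partition (n : ℕ)

namespace IntegerPartition

/-- The sum `|λ|` of the parts of `λ`. -/
def size (l : IntegerPartition) : ℕ := l.1

/-- The multiset of the parts of `λ`. -/
def parts (l : IntegerPartition) : Multiset ℕ := l.2.parts

end IntegerPartition

/-- A partitional labeling: an integer partition for each vertex that is not the root. -/
abbrev PartitionalLabeling (Q : RootedTree.{u}) : Type u :=
  {a : Q // a ≠ ⊥} → IntegerPartition

namespace PartitionalLabeling

/-- The labeling `Λ_a` of the subtree `Q_a`, whose root `a` becomes unlabeled. -/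
def restrict {Q : RootedTree.{u}} (L : PartitionalLabeling Q) (a : Q) :
    PartitionalLabeling (Q.below a) :=
  fun c => L ⟨c.1.1, fun h => c.2 (Subtype.ext
    (le_antisymm (h.le.trans bot_le) c.1.2))⟩

/-- Isomorphism of partitional labelings. -/
def Isomorphic {Q : RootedTree.{u}} {Q' : RootedTree.{u}} (L : PartitionalLabeling Q)
    (M : PartitionalLabeling Q') : Prop :=
  ∃ γ : Q ≃o Q', ∀ a : {a : Q // a ≠ ⊥},
    L a = M ⟨γ a.1, fun h => a.2 (γ.injective (h.trans γ.map_bot.symm))⟩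

theorem Isomorphic.refl {Q : RootedTree.{u}} (L : PartitionalLabeling Q) : L.Isomorphic L :=
  ⟨OrderIso.refl Q, fun _ => rfl⟩

theorem Isomorphic.symm {Q Q' : RootedTree.{u}} {L : PartitionalLabeling Q}
    {M : PartitionalLabeling Q'} : L.Isomorphic M → M.Isomorphic L := by
  rintro ⟨γ, hγ⟩
  refine ⟨γ.symm, fun a => ?_⟩
  rw [hγ]
  congr 1
  exact Subtype.ext (γ.apply_symm_apply a.1).symm

theorem Isomorphic.trans {Q Q' Q'' : RootedTree.{u}} {L : PartitionalLabeling Q}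
    {M : PartitionalLabeling Q'} {N : PartitionalLabeling Q''} :
    L.Isomorphic M → M.Isomorphic N → L.Isomorphic N := by
  rintro ⟨γ, hγ⟩ ⟨δ, hδ⟩
  exact ⟨γ.trans δ, fun a => (hγ a).trans (hδ _)⟩

end PartitionalLabeling

/-- A tree of partitions `(Λ, Q)`. -/
structure TreeOfPartitions : Type (u + 1) where
  tree : RootedTree.{u}
  finite : Finite tree
  label : PartitionalLabeling tree
  /-- Among the children of a vertex at most one is a leaf. -/
  leaf_unique : ∀ a b : tree, RootedTree.Siblings a b → IsMax a → IsMax b → a = b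
  /-- Distinct internal siblings `a`, `b` have non-isomorphic labelings `Λ_a`, `Λ_b`. -/
  not_isomorphic : ∀ a b : tree, RootedTree.Siblings a b → a ≠ b → ¬ IsMax a → ¬ IsMax b →
    ¬ (label.restrict a).Isomorphic (label.restrict b)

namespace TreeOfPartitions

/-- Trees of partitions up to isomorphism of their labelings. -/
instance setoid : Setoid TreeOfPartitions.{u} where
  r L M := L.label.Isomorphic M.label
  iseqv := ⟨fun L => .refl L.label, .symm, .trans⟩

/-- `L = (Λ, Q)` is the tree of partitions associated to the tree composition `φ : T → P`: for the
quotient `α : P → Q` of `φ`, every vertex `u` of `T` and every child `b` of `α (φ u)`, the parts of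
`λ^b` are the numbers of children of `u` over `y`, where `y` runs through the children of `φ u`
over `b`. -/
def IsAssociated (L : TreeOfPartitions.{u}) {T P : RootedTree.{u}} [Finite P]
    (φ : TreeComposition T P) : Prop :=
  ∃ α : TreeComposition P L.tree, φ.IsQuotient α ∧
    ∀ (u : T) (b : {b : L.tree // b ≠ ⊥}), α (φ u) ⋖ b.1 →
      (L.label b).parts =
        (Set.toFinite {y : P | φ u ⋖ y ∧ α y = b.1}).toFinset.val.map
          (fun y => Set.ncard {t : T | u ⋖ t ∧ φ t = y})

/-- `δ : T → Q` is a realization of `(Λ, Q)` as a tree of partitions of `T`: every `u` in `T` has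
exactly `|λ^b|` children over each child `b` of `δ u`. -/
def IsRealization (L : TreeOfPartitions.{u}) {T : RootedTree.{u}}
    (δ : TreeComposition T L.tree) : Prop :=
  ∀ (u : T) (b : {b : L.tree // b ≠ ⊥}), δ u ⋖ b.1 →
    (L.label b).size = Set.ncard {t : T | u ⋖ t ∧ δ t = b.1}

end TreeOfPartitions

/-- `Par(T)`: the set of the trees of partitions, up to isomorphism, that have a realization as a
tree of partitions of `T`. -/
def Par (T : RootedTree.{u}) : Set (Quotient TreeOfPartitions.setoid.{u}) :=
  {q | ∃ L : TreeOfPartitions.{u}, q = Quotient.mk _ L ∧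
    ∃ δ : TreeComposition T L.tree, L.IsRealization δ}

section Orbits

variable (T : RootedTree.{u})

/-- `u` and `v` are in the same `g`-orbit. -/
def orbitSetoid (g : T ≃o T) : Setoid T where
  r u v := ∃ k : ℤ, (g ^ k) u = v
  iseqv := by
    refine ⟨fun u => ⟨0, by simp⟩, ?_, ?_⟩
    · rintro u v ⟨k, rfl⟩
      exact ⟨-k, by rw [← RelIso.mul_apply, ← zpow_add]; simp⟩
    · rintro u v w ⟨k, rfl⟩ ⟨l, rfl⟩
      exact ⟨l + k, by rw [zpow_add, RelIso.mul_apply]⟩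

/-- The set of the `g`-orbits on the vertices of `T`. -/
def Orbits (g : T ≃o T) : Type u := Quotient (orbitSetoid T g)

variable {T}

/-- The `g`-orbit of `u`. -/
def orbitMk (g : T ≃o T) (u : T) : Orbits T g := Quotient.mk (orbitSetoid T g) u

theorem orbitMk_eq {g : T ≃o T} {u v : T} :
    orbitMk g u = orbitMk g v ↔ ∃ k : ℤ, (g ^ k) u = v :=
  Quotient.eq (r := orbitSetoid T g)

theorem orbitMk_zpow (g : T ≃o T) (k : ℤ) (u : T) : orbitMk g ((g ^ k) u) = orbitMk g u :=
  (orbitMk_eq.2 ⟨k, rfl⟩).symm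

theorem orbitMk_surjective (g : T ≃o T) : Function.Surjective (orbitMk g) :=
  Quotient.exists_rep

instance [Finite T] (g : T ≃o T) : Finite (Orbits T g) :=
  Finite.of_surjective _ (orbitMk_surjective g)

/-- The ancestor relation on orbits: some vertex of the first orbit is an ancestor of, or equal to,
some vertex of the second. -/
instance (g : T ≃o T) : LE (Orbits T g) :=
  ⟨fun x y => ∃ u v : T, orbitMk g u = x ∧ orbitMk g v = y ∧ u ≤ v⟩

theorem orbitMk_le {g : T ≃o T} {x : Orbits T g} {v : T} :
    x ≤ orbitMk g v ↔ ∃ u, orbitMk g u = x ∧ u ≤ v := by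
  constructor
  · rintro ⟨u, v', rfl, hv, h⟩
    obtain ⟨k, rfl⟩ := orbitMk_eq.1 hv
    exact ⟨(g ^ k) u, orbitMk_zpow g k u, (g ^ k).monotone h⟩
  · rintro ⟨u, hu, h⟩
    exact ⟨u, v, hu, rfl, h⟩

theorem eq_of_orbitMk_eq_of_le [Finite T] {g : T ≃o T} {u v : T}
    (h : orbitMk g u = orbitMk g v) (huv : u ≤ v) : u = v := by
  obtain ⟨k, rfl⟩ := orbitMk_eq.1 h
  generalize g ^ k = f at huv
  have : Finite (T ≃o T) := Finite.of_injective (fun e : T ≃o T => (e : T → T))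
    DFunLike.coe_injective
  obtain ⟨n, hn, hf⟩ := (isOfFinOrder_of_finite f).exists_pow_eq_one
  have key : ∀ m : ℕ, f u ≤ (f ^ (m + 1)) u := by
    intro m
    induction m with
    | zero => simp
    | succ m ih =>
      refine ih.trans ?_
      conv_rhs => rw [pow_succ, RelIso.mul_apply]
      exact (f ^ (m + 1)).monotone huv
  obtain ⟨m, rfl⟩ : ∃ m, n = m + 1 := ⟨n - 1, by omega⟩
  have := key m
  rw [hf, RelIso.one_apply] at this
  exact le_antisymm huv this

instance [Finite T] (g : T ≃o T) : PartialOrder (Orbits T g) where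
  le_refl x := by
    obtain ⟨u, rfl⟩ := orbitMk_surjective g x
    exact ⟨u, u, rfl, rfl, le_rfl⟩
  le_trans x y z := by
    obtain ⟨w, rfl⟩ := orbitMk_surjective g z
    intro hxy hyz
    obtain ⟨v, rfl, hv⟩ := orbitMk_le.1 hyz
    obtain ⟨u, rfl, hu⟩ := orbitMk_le.1 hxy
    exact ⟨u, w, rfl, rfl, hu.trans hv⟩
  le_antisymm x y hxy hyx := by
    obtain ⟨v, rfl⟩ := orbitMk_surjective g y
    obtain ⟨u, rfl, hu⟩ := orbitMk_le.1 hxy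
    obtain ⟨v', hv', hv⟩ := orbitMk_le.1 hyx
    have h := eq_of_orbitMk_eq_of_le hv' (hv.trans hu)
    rw [le_antisymm hu (h ▸ hv)]

instance [Finite T] (g : T ≃o T) : OrderBot (Orbits T g) where
  bot := orbitMk g ⊥
  bot_le x := by
    obtain ⟨u, rfl⟩ := orbitMk_surjective g x
    exact ⟨⊥, u, rfl, rfl, bot_le⟩

/-- The tree `P^g` of the `g`-orbits. -/
noncomputable def orbitTree [Finite T] (g : T ≃o T) : RootedTree.{u} :=
  RootedTree.ofChains (Orbits T g) (by
    intro a b c hac hbc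
    obtain ⟨w, rfl⟩ := orbitMk_surjective g c
    obtain ⟨u, rfl, hu⟩ := orbitMk_le.1 hac
    obtain ⟨v, rfl, hv⟩ := orbitMk_le.1 hbc
    rcases le_total_of_directed hu hv with h | h
    · exact Or.inr ⟨v, u, rfl, rfl, h⟩
    · exact Or.inl ⟨u, v, rfl, rfl, h⟩)

instance [Finite T] (g : T ≃o T) : Finite (orbitTree g) :=
  inferInstanceAs (Finite (Orbits T g))

theorem orbitMk_covBy [Finite T] {g : T ≃o T} {p u : T} (h : p ⋖ u) :
    orbitMk g p ⋖ orbitMk g u := by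
  refine ⟨lt_of_le_of_ne ⟨p, u, rfl, rfl, h.le⟩
    fun he => h.lt.ne (eq_of_orbitMk_eq_of_le he h.le), fun c hpc hcu => ?_⟩
  obtain ⟨v, rfl, hv⟩ := orbitMk_le.1 hcu.le
  obtain ⟨p', hp', hpv⟩ := orbitMk_le.1 hpc.le
  have hvu : v < u := lt_of_le_of_ne hv (fun he => hcu.ne (by rw [he]))
  have hp'v : p' < v := lt_of_le_of_ne hpv (fun he => hpc.ne (by rw [← hp', he]))
  have hpp : p' = p := by
    rcases le_total_of_directed (hp'v.le.trans hv) h.le with hle | hle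
    · exact (eq_of_orbitMk_eq_of_le hp'.symm hle).symm
    · exact eq_of_orbitMk_eq_of_le hp' hle
  subst hpp
  exact h.2 hp'v hvu

theorem orbitMk_isMax [Finite T] {g : T ≃o T} {u : T} (h : IsMax u) :
    IsMax (orbitMk g u) := by
  intro y hy
  obtain ⟨v, rfl⟩ := orbitMk_surjective g y
  obtain ⟨u', hu', hv⟩ := orbitMk_le.1 hy
  obtain ⟨k, rfl⟩ := orbitMk_eq.1 hu'.symm
  have hmax : IsMax ((g ^ k) u) := (OrderIso.isMax_apply (g ^ k)).2 h
  exact ⟨v, (g ^ k) u, rfl, hu', hmax hv⟩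

/-- The tree composition `φ^g : T → P^g`, which maps a vertex to its `g`-orbit. -/
noncomputable def orbitComposition [Finite T] (g : T ≃o T) : TreeComposition T (orbitTree g) where
  toFun := orbitMk g
  map_root := rfl
  map_child h := orbitMk_covBy h
  map_leaf h := orbitMk_isMax h
  surjective := orbitMk_surjective g
  regular u v _ _ _ _ h := by
    obtain ⟨k, hk⟩ := orbitMk_eq.1 h
    exact ⟨g ^ k, hk, fun t _ => (orbitMk_zpow g k t).symm⟩

end Orbits

/-! Call a surjective homomorphism `φ : T → P` equitable if the number of children of `t` over a
child `y` of `φ t` depends on `y` only. Orbit maps are equitable, since powers of `g` carry children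
to children. Conversely, the fibers of an equitable `φ` are the orbits of an automorphism, which
advances an odometer-like numbering of every fiber (`Equitable.exists_automorphism`), and
automorphisms with the same orbits are conjugate (`isConj_of_orbits`). So conjugacy classes of
`Aut(T)` correspond to equivalence classes of equitable maps on `T`.

These classes are encoded by trees of partitions. Color each `t` by the equivalence class of `φ_t`
and let `Q` be the tree of color sequences along paths from the root; the label of `b` lists the
multiplicities of the vertices of `P` over `b` (`Equitable.exists_treeOfPartitions`). The labels
determine `φ` up to equivalence, because equal numbers of children allow isomorphisms to be built
level by level (`LabeledBy.equivalent`). Conversely `φ` determines the labels: distinct internal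
siblings in a tree of partitions carry non-isomorphic labelings, so by induction on size siblings of
`T` with equivalent restrictions have the same image in `Q` (`LabeledBy.separated`), and an
equivalence then descends to an isomorphism of labelings.

Every element of `Par(T)` occurs: cutting the children over `b` into blocks whose sizes are the
parts of the label of `b` refines a realization to an equitable map
(`IsRealization.exists_labeledBy`). -/

namespace RootedTree

/-! ### Parents, children, and isomorphisms built level by level. -/

variable {T : RootedTree.{u}}

theorem covBy_iff_pred {p t : T} : p ⋖ t ↔ t ≠ ⊥ ∧ Order.pred t = p := by
  constructor
  · intro h
    exact ⟨fun hb => not_lt_bot (hb ▸ h.lt), h.pred_eq⟩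
  · rintro ⟨h, rfl⟩
    exact Order.pred_covBy_of_not_isMin (fun hm => h hm.eq_bot)

theorem pred_covBy {t : T} (h : t ≠ ⊥) : Order.pred t ⋖ t :=
  covBy_iff_pred.2 ⟨h, rfl⟩

theorem ne_bot_of_covBy {p t : T} (h : p ⋖ t) : t ≠ ⊥ := (covBy_iff_pred.1 h).1

theorem covBy_unique {p q t : T} (hp : p ⋖ t) (hq : q ⋖ t) : p = q :=
  hp.pred_eq.symm.trans hq.pred_eq

theorem lt_iff_le_of_covBy {p s t : T} (h : p ⋖ t) : s < t ↔ s ≤ p :=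
  ⟨fun hs => h.pred_eq ▸ Order.le_pred_of_lt hs, fun hs => hs.trans_lt h.lt⟩

theorem le_covBy_iff {p s t : T} (h : p ⋖ t) : s ≤ t ↔ s = t ∨ s ≤ p := by
  rw [le_iff_eq_or_lt, lt_iff_le_of_covBy h]

theorem le_total_of_le {a b c : T} (ha : a ≤ c) (hb : b ≤ c) : a ≤ b ∨ b ≤ a :=
  (le_total_of_directed ha hb).symm

/-- Induction from a vertex to its descendants. -/
theorem induction_above {r : T} {C : T → Prop} (h0 : C r)
    (hs : ∀ p t, r ≤ p → p ⋖ t → C p → C t) {t : T} (ht : r ≤ t) : C t := by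
  obtain ⟨n, hn⟩ := ht.exists_pred_iterate
  induction n generalizing t with
  | zero => simp only [Function.iterate_zero, id] at hn; rwa [hn]
  | succ n ih =>
    by_cases hb : t = ⊥
    · rwa [le_antisymm (hb ▸ bot_le : t ≤ r) ht]
    · rw [Function.iterate_succ_apply] at hn
      have hle : r ≤ Order.pred t := hn ▸ Order.pred_iterate_le n _
      exact hs _ _ hle (pred_covBy hb) (ih hle hn)

/-- Induction from the root. -/
theorem induction_root {C : T → Prop} (h0 : C ⊥) (hs : ∀ p t, p ⋖ t → C p → C t) (t : T) : C t :=
  induction_above h0 (fun p t _ => hs p t) bot_le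

/-- Recursion from the root. -/
theorem exists_rec [Finite T] {A : Type w} (a : A) (step : T → A → A) :
    ∃ f : T → A, f ⊥ = a ∧ ∀ t, t ≠ ⊥ → f t = step t (f (Order.pred t)) := by
  classical
  let F : (t : T) → ((s : T) → s < t → A) → A := fun t ih =>
    if h : t = ⊥ then a else step t (ih (Order.pred t) (pred_covBy h).lt)
  have wf : WellFounded ((· < ·) : T → T → Prop) := wellFounded_lt
  refine ⟨wf.fix F, ?_, fun t ht => ?_⟩
  · rw [wf.fix_eq]; simp [F]
  · rw [wf.fix_eq]; simp [F, ht]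

theorem eq_bot_or_covBy (t : T) : t = ⊥ ∨ ∃ p, p ⋖ t :=
  (em _).imp_right fun h => ⟨_, pred_covBy h⟩

theorem exists_covBy_of_lt {s t : T} (h : s < t) : ∃ p, p ⋖ t ∧ s ≤ p := by
  rcases eq_bot_or_covBy t with rfl | ⟨p, hp⟩
  · exact absurd h not_lt_bot
  · exact ⟨p, hp, (lt_iff_le_of_covBy hp).1 h⟩

/-- A vertex below `t` that is a proper ancestor has a child on the path to `t`. -/
theorem exists_child_of_lt {s t : T} (h : s < t) : ∃ c, s ⋖ c ∧ c ≤ t := by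
  refine induction_above (r := s) (C := fun t => s < t → ∃ c, s ⋖ c ∧ c ≤ t)
    (fun h => absurd h (lt_irrefl _)) ?_ h.le h
  intro p t hp hpt ih _
  rcases hp.eq_or_lt with rfl | hlt
  · exact ⟨t, hpt, le_rfl⟩
  · obtain ⟨c, hc, hcp⟩ := ih hlt
    exact ⟨c, hc, hcp.trans hpt.le⟩

theorem exists_child_of_not_isMax {s : T} (h : ¬ IsMax s) : ∃ c, s ⋖ c := by
  obtain ⟨t, ht⟩ := not_isMax_iff.1 h
  obtain ⟨c, hc, _⟩ := exists_child_of_lt ht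
  exact ⟨c, hc⟩

theorem not_le_of_siblings {p u v : T} (hu : p ⋖ u) (hv : p ⋖ v) (h : u ≠ v) : ¬ u ≤ v := by
  intro hle
  have := (lt_iff_le_of_covBy hv).1 (lt_of_le_of_ne hle h)
  exact hu.lt.not_ge this

/-- An isomorphism between the subtrees below two siblings extends to an automorphism. -/
theorem exists_swap {p u v : T} (hu : p ⋖ u) (hv : p ⋖ v) (hne : u ≠ v)
    (e : T.below u ≃o T.below v) : ∃ τ : T ≃o T, ∀ t : T.below u, τ t.1 = (e t).1 := by
  classical
  have hdisj : ∀ s : T, u ≤ s → ¬ v ≤ s := by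
    intro s h1 h2
    rcases le_total_of_le h1 h2 with h | h
    · exact not_le_of_siblings hu hv hne h
    · exact not_le_of_siblings hv hu hne.symm h
  -- `f` exchanges the two subtrees and fixes everything else. It is an involution, so monotonicity
  -- alone makes it an order isomorphism.
  let f : T → T := fun t =>
    if h : u ≤ t then (e ⟨t, h⟩).1 else if h : v ≤ t then (e.symm ⟨t, h⟩).1 else t
  have fu : ∀ t (h : u ≤ t), f t = (e ⟨t, h⟩).1 := fun t h => dif_pos h
  have fv : ∀ t (h : v ≤ t), f t = (e.symm ⟨t, h⟩).1 := fun t h => by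
    have : ¬ u ≤ t := fun h' => hdisj t h' h
    simp [f, this, h]
  have fo : ∀ t, ¬ u ≤ t → ¬ v ≤ t → f t = t := fun t h h' => by simp [f, h, h']
  have hinv : ∀ t, f (f t) = t := by
    intro t
    by_cases h : u ≤ t
    · rw [fu t h, fv _ (e ⟨t, h⟩).2]
      exact congrArg Subtype.val (e.symm_apply_apply ⟨t, h⟩)
    · by_cases h' : v ≤ t
      · rw [fv t h', fu _ (e.symm ⟨t, h'⟩).2]
        exact congrArg Subtype.val (e.apply_symm_apply ⟨t, h'⟩)
      · rw [fo t h h', fo t h h']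
  have hmono : Monotone f := by
    intro s t hst
    by_cases h1 : u ≤ s
    · rw [fu s h1, fu t (h1.trans hst)]
      exact e.monotone (a := ⟨s, h1⟩) (b := ⟨t, h1.trans hst⟩) hst
    · by_cases h2 : v ≤ s
      · rw [fv s h2, fv t (h2.trans hst)]
        exact e.symm.monotone (a := ⟨s, h2⟩) (b := ⟨t, h2.trans hst⟩) hst
      · rw [fo s h1 h2]
        by_cases h3 : u ≤ t
        -- A vertex outside `T_u` with a descendant in `T_u` is an ancestor of `p`, hence of every
        -- vertex of `T_v`.
        · have : s ≤ p := by
            rcases le_total_of_le hst h3 with h | h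
            · exact (lt_iff_le_of_covBy hu).1 (lt_of_le_of_ne h fun he => h1 he.ge)
            · exact absurd h h1
          rw [fu t h3]
          exact (this.trans hv.le).trans (e ⟨t, h3⟩).2
        · by_cases h4 : v ≤ t
          · have : s ≤ p := by
              rcases le_total_of_le hst h4 with h | h
              · exact (lt_iff_le_of_covBy hv).1 (lt_of_le_of_ne h fun he => h2 he.ge)
              · exact absurd h h2
            rw [fv t h4]
            exact (this.trans hu.le).trans (e.symm ⟨t, h4⟩).2
          · rw [fo t h3 h4]; exact hst
  refine ⟨{ toFun := f, invFun := f, left_inv := hinv, right_inv := hinv, map_rel_iff' := ?_ },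
    fun t => fu t.1 t.2⟩
  intro s t
  exact ⟨fun h => by simpa [hinv] using hmono h, fun h => hmono h⟩

/-- A relation between the vertices of two trees that restricts to bijections between children
contains an isomorphism of the subtrees below related vertices. -/
theorem exists_orderIso_below {X : RootedTree.{u}} {Y : RootedTree.{v}} [Finite X]
    (R : X → Y → Prop)
    (hR : ∀ x y, R x y → ∃ e : {t // x ⋖ t} ≃ {t // y ⋖ t}, ∀ t, R t.1 (e t).1)
    {u : X} {v : Y} (huv : R u v) :
    ∃ f : X.below u ≃o Y.below v, ∀ t, R t.1 (f t).1 := by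
  classical
  choose e he using hR
  -- The recursion runs from the root of `X` but is reset to `v` at `u`; the values outside the
  -- subtree of `u` are irrelevant.
  obtain ⟨f, hf0, hfs⟩ := exists_rec (T := X) v fun t z =>
    if t = u then v else
      if h : R (Order.pred t) z ∧ Order.pred t ⋖ t then (e _ _ h.1 ⟨t, h.2⟩).1 else v
  have fu : f u = v := by
    by_cases h : u = ⊥
    · rw [h, hf0]
    · rw [hfs u h, if_pos rfl]
  have fstep : ∀ p t, u ≤ p → (hpt : p ⋖ t) → (h : R p (f p)) →
      f t = (e p (f p) h ⟨t, hpt⟩).1 := by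
    intro p t hp hpt h
    obtain ⟨hb, rfl⟩ := covBy_iff_pred.1 hpt
    have hne : t ≠ u := (hp.trans_lt hpt.lt).ne'
    rw [hfs t hb, if_neg hne, dif_pos ⟨h, hpt⟩]
  have hRf : ∀ t, u ≤ t → R t (f t) := by
    intro t ht
    refine induction_above (C := fun t => R t (f t)) (by rwa [fu]) ?_ ht
    intro p t hp hpt h
    rw [fstep p t hp hpt h]
    exact he p (f p) h ⟨t, hpt⟩
  have hcov : ∀ p t, u ≤ p → p ⋖ t → f p ⋖ f t := by
    intro p t hp hpt
    rw [fstep p t hp hpt (hRf p hp)]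
    exact (e p (f p) _ ⟨t, hpt⟩).2
  have hmono : ∀ s t, u ≤ s → s ≤ t → f s ≤ f t := by
    intro s t hs hst
    refine induction_above (C := fun t => f s ≤ f t) le_rfl ?_ hst
    intro p t hp hpt h
    exact h.trans (hcov p t (hs.trans hp) hpt).le
  have hge : ∀ t, u ≤ t → v ≤ f t := fun t ht => fu ▸ hmono u t le_rfl ht
  have hbase : ∀ t, u ≤ t → f t = v → t = u := by
    intro t ht h
    by_contra hne
    obtain ⟨p, hp, hup⟩ := exists_covBy_of_lt (lt_of_le_of_ne ht (Ne.symm hne))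
    have := (hcov p t hup hp).lt
    rw [h] at this
    exact this.not_ge (hge p hup)
  have hinj : ∀ s, u ≤ s → ∀ t, u ≤ t → f s = f t → s = t := by
    intro s hs
    refine induction_above (C := fun s => ∀ t, u ≤ t → f s = f t → s = t) ?_ ?_ hs
    · intro t ht h
      exact (hbase t ht (h.symm.trans fu)).symm
    · intro p s hp hps ih t ht h
      by_cases htu : t = u
      · subst htu
        exact hbase s (hp.trans hps.le) (h.trans fu)
      · obtain ⟨q, hq, huq⟩ := exists_covBy_of_lt (lt_of_le_of_ne ht (Ne.symm htu))
        have h1 := hcov p s hp hps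
        have h2 := hcov q t huq hq
        obtain rfl := ih q huq (covBy_unique (h ▸ h1) h2)
        rw [fstep p s hp hps (hRf p hp), fstep p t hp hq (hRf p hp)] at h
        exact congrArg Subtype.val ((e p (f p) _).injective (Subtype.ext h))
  have hsurj : ∀ y, v ≤ y → ∃ x, u ≤ x ∧ f x = y := by
    intro y hy
    refine induction_above (C := fun y => ∃ x, u ≤ x ∧ f x = y) ⟨u, le_rfl, fu⟩ ?_ hy
    rintro q y - hqy ⟨x, hx, rfl⟩
    obtain ⟨t, ht⟩ := (e x (f x) (hRf x hx)).surjective ⟨y, hqy⟩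
    refine ⟨t.1, hx.trans t.2.le, ?_⟩
    rw [fstep x t.1 hx t.2 (hRf x hx), ht]
  have hrefl : ∀ t, u ≤ t → ∀ s, u ≤ s → f s ≤ f t → s ≤ t := by
    intro t ht
    refine induction_above (C := fun t => ∀ s, u ≤ s → f s ≤ f t → s ≤ t) ?_ ?_ ht
    · intro s hs h
      rw [hbase s hs (le_antisymm (fu ▸ h) (hge s hs))]
    · intro p t hp hpt ih s hs h
      rcases (le_covBy_iff (hcov p t hp hpt)).1 h with h | h
      · rw [hinj s hs t (hp.trans hpt.le) h]
      · exact (ih s hs h).trans hpt.le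
  let g : X.below u → Y.below v := fun t => ⟨f t.1, hge t.1 t.2⟩
  have hg : Function.Bijective g := by
    constructor
    · intro s t h
      exact Subtype.ext (hinj s.1 s.2 t.1 t.2 (congrArg Subtype.val h))
    · intro y
      obtain ⟨x, hx, h⟩ := hsurj y.1 y.2
      exact ⟨⟨x, hx⟩, Subtype.ext h⟩
  refine ⟨{ toEquiv := Equiv.ofBijective g hg, map_rel_iff' := ?_ }, fun t => hRf t.1 t.2⟩
  intro s t
  exact ⟨fun h => hrefl t.1 t.2 s.1 s.2 h, fun h => hmono s.1 t.1 s.2 h⟩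

/-- A color attained on neither side has two empty fibers, so comparing fibers over attained colors
suffices to glue bijections fiber by fiber. -/
theorem _root_.exists_equiv_of_card_fiber {S : Type u} {S' : Type v} {A : Type w} [Finite S]
    [Finite S'] (c : S → A) (d : S' → A)
    (h1 : ∀ s, Nat.card {x // c x = c s} = Nat.card {x // d x = c s})
    (h2 : ∀ s, Nat.card {x // c x = d s} = Nat.card {x // d x = d s}) :
    ∃ e : S ≃ S', ∀ s, d (e s) = c s := by
  have h : ∀ a, Nonempty ({x // c x = a} ≃ {x // d x = a}) := by
    intro a
    rw [← Finite.card_eq]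
    by_cases ha : ∃ s, c s = a
    · obtain ⟨s, rfl⟩ := ha
      exact h1 s
    · by_cases hb : ∃ s, d s = a
      · obtain ⟨s, rfl⟩ := hb
        exact h2 s
      · push Not at ha hb
        have := Subtype.isEmpty_of_false ha
        have := Subtype.isEmpty_of_false hb
        simp
  have f := fun a => (h a).some
  refine ⟨(Equiv.sigmaFiberEquiv c).symm.trans
    ((Equiv.sigmaCongrRight f).trans (Equiv.sigmaFiberEquiv d)), fun s => ?_⟩
  exact (f (c s) ⟨s, rfl⟩).2

theorem card_children_eq_ncard {Z : RootedTree.{u}} {z : Z} {A : Type w} (g : Z → A) (a : A) :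
    Nat.card {t : {t // z ⋖ t} // g t.1 = a} = {t | z ⋖ t ∧ g t = a}.ncard := by
  rw [← Nat.card_coe_set_eq]
  exact Nat.card_congr (Equiv.subtypeSubtypeEquivSubtypeInter (fun t => z ⋖ t) fun t => g t = a)

/-- A bijection between the children of two vertices that preserves colors. -/
theorem exists_equiv_children {X : RootedTree.{u}} {Y : RootedTree.{v}} [Finite X] [Finite Y]
    {A : Type w} (c : X → A) (d : Y → A) {x : X} {y : Y}
    (h1 : ∀ s, x ⋖ s → {t | x ⋖ t ∧ c t = c s}.ncard = {t | y ⋖ t ∧ d t = c s}.ncard)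
    (h2 : ∀ s, y ⋖ s → {t | x ⋖ t ∧ c t = d s}.ncard = {t | y ⋖ t ∧ d t = d s}.ncard) :
    ∃ e : {t // x ⋖ t} ≃ {t // y ⋖ t}, ∀ t, d (e t).1 = c t.1 := by
  refine exists_equiv_of_card_fiber (fun t : {t // x ⋖ t} => c t.1)
    (fun t : {t // y ⋖ t} => d t.1) (fun s => ?_) fun s => ?_
  · rw [card_children_eq_ncard c, card_children_eq_ncard d]; exact h1 s.1 s.2
  · rw [card_children_eq_ncard c, card_children_eq_ncard d]; exact h2 s.1 s.2

end RootedTree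

/-! ### Homomorphisms, factorization and equitable maps. -/

namespace TreeHom

open RootedTree

variable {T : RootedTree.{u}} {P : RootedTree.{v}}

theorem isMax_iff (φ : TreeHom T P) {t : T} : IsMax (φ t) ↔ IsMax t := by
  refine ⟨fun h => ?_, φ.map_leaf⟩
  by_contra hn
  obtain ⟨c, hc⟩ := exists_child_of_not_isMax hn
  exact h.not_lt (φ.map_child hc).lt

theorem eq_bot (φ : TreeHom T P) {t : T} (h : φ t = ⊥) : t = ⊥ := by
  rcases eq_bot_or_covBy t with rfl | ⟨p, hp⟩
  · rfl
  · exact absurd h (ne_bot_of_covBy (φ.map_child hp))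

theorem exists_covBy (φ : TreeHom T P) {x : P} {t : T} (h : x ⋖ φ t) :
    ∃ p, p ⋖ t ∧ φ p = x := by
  rcases eq_bot_or_covBy t with rfl | ⟨p, hp⟩
  · exact absurd φ.map_root (ne_bot_of_covBy h)
  · exact ⟨p, hp, covBy_unique (φ.map_child hp) h⟩

theorem strictMono (φ : TreeHom T P) : StrictMono φ := by
  intro s t h
  obtain ⟨p, hp, hs⟩ := exists_covBy_of_lt h
  exact (φ.monotone hs).trans_lt (φ.map_child hp).lt

theorem eq_of_le (φ : TreeHom T P) {s t : T} (h : s ≤ t) (he : φ s = φ t) : s = t := by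
  by_contra hne
  exact (φ.strictMono (lt_of_le_of_ne h hne)).ne he

theorem eq_of_le_of_le (φ : TreeHom T P) {s s' t : T} (h : s ≤ t) (h' : s' ≤ t)
    (he : φ s = φ s') : s = s' := by
  rcases le_total_of_le h h' with hle | hle
  · exact φ.eq_of_le hle he
  · exact (φ.eq_of_le hle he.symm).symm

/-- A homomorphism that is constant on the fibers of a surjective homomorphism factors. -/
theorem exists_factor {Q : RootedTree.{w}} (φ : TreeHom T P) (hφ : Function.Surjective φ)
    (δ : TreeHom T Q) (h : ∀ s t, φ s = φ t → δ s = δ t) :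
    ∃ α : TreeHom P Q, ∀ t, α (φ t) = δ t := by
  choose s hs using hφ
  refine ⟨⟨fun x => δ (s x), ?_, ?_, ?_⟩, fun t => h _ _ (hs _)⟩
  · rw [φ.eq_bot (hs ⊥), δ.map_root]
  · intro p x hpx
    rw [← hs x] at hpx
    obtain ⟨r, hr, hrp⟩ := φ.exists_covBy hpx
    rw [h _ r ((hs p).trans hrp.symm)]
    exact δ.map_child hr
  · intro x hx
    rw [← hs x] at hx
    exact δ.map_leaf (φ.isMax_iff.1 hx)

/-- Surjective homomorphisms with the same fibers have isomorphic targets. -/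
theorem exists_orderIso {Q : RootedTree.{w}} (φ : TreeHom T P) (hφ : Function.Surjective φ)
    (δ : TreeHom T Q) (hδ : Function.Surjective δ) (h : ∀ s t, φ s = φ t ↔ δ s = δ t) :
    ∃ ω : P ≃o Q, ∀ t, ω (φ t) = δ t := by
  obtain ⟨α, hα⟩ := φ.exists_factor hφ δ fun s t => (h s t).1
  obtain ⟨β, hβ⟩ := δ.exists_factor hδ φ fun s t => (h s t).2
  have hβα : ∀ x, β (α x) = x := by
    intro x
    obtain ⟨t, rfl⟩ := hφ x
    rw [hα, hβ]
  have hαβ : ∀ x, α (β x) = x := by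
    intro x
    obtain ⟨t, rfl⟩ := hδ x
    rw [hβ, hα]
  refine ⟨{ toFun := α, invFun := β, left_inv := hβα, right_inv := hαβ, map_rel_iff' := ?_ }, hα⟩
  intro a b
  refine ⟨fun hab => ?_, fun hab => α.monotone hab⟩
  have := β.monotone hab
  simpa [hβα] using this

/-- The homomorphism given by an isomorphism. -/
def ofOrderIso (ω : T ≃o P) : TreeHom T P where
  toFun := ω
  map_root := ω.map_bot
  map_child h := (apply_covBy_apply_iff ω).2 h
  map_leaf h := (OrderIso.isMax_apply ω).2 h

/-- Composition of homomorphisms. -/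
def comp {Q : RootedTree.{w}} (α : TreeHom P Q) (φ : TreeHom T P) : TreeHom T Q where
  toFun t := α (φ t)
  map_root := by rw [φ.map_root, α.map_root]
  map_child h := α.map_child (φ.map_child h)
  map_leaf h := α.map_leaf (φ.map_leaf h)

/-- A surjective homomorphism is equitable with multiplicities `m` if a vertex has `m y` children
over each child `y` of its image. -/
structure Equitable (φ : TreeHom T P) (m : P → ℕ) : Prop where
  surjective : Function.Surjective φ
  card : ∀ (t : T) (y : P), φ t ⋖ y → {s | t ⋖ s ∧ φ s = y}.ncard = m y

theorem exists_equitable (φ : TreeHom T P) (hφ : Function.Surjective φ)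
    (h : ∀ s t, φ s = φ t → ∀ y, φ t ⋖ y →
      {r | s ⋖ r ∧ φ r = y}.ncard = {r | t ⋖ r ∧ φ r = y}.ncard) :
    ∃ m, φ.Equitable m := by
  classical
  -- Any vertex over the parent of `y` may be used to count; the value 0 is taken at the root only.
  refine ⟨fun y => if hy : ∃ t, φ t ⋖ y then {s | hy.choose ⋖ s ∧ φ s = y}.ncard else 0,
    hφ, fun t y hty => ?_⟩
  have hy : ∃ t, φ t ⋖ y := ⟨t, hty⟩
  rw [dif_pos hy]
  exact h _ _ (covBy_unique hty hy.choose_spec) y hy.choose_spec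

namespace Equitable

variable {φ : TreeHom T P} {m : P → ℕ}

theorem pos [Finite T] (h : φ.Equitable m) {x y : P} (hxy : x ⋖ y) : 0 < m y := by
  obtain ⟨t, rfl⟩ := h.surjective y
  obtain ⟨p, hp, rfl⟩ := φ.exists_covBy hxy
  rw [← h.card p _ hxy]
  exact (Set.ncard_pos (Set.toFinite _)).2 ⟨t, hp, rfl⟩

theorem exists_child [Finite T] (h : φ.Equitable m) {t : T} {y : P} (hty : φ t ⋖ y) :
    ∃ s, t ⋖ s ∧ φ s = y := by
  have := h.pos hty
  rw [← h.card t y hty] at this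
  exact (Set.ncard_pos (Set.toFinite _)).1 this

theorem finite [Finite T] (h : φ.Equitable m) : Finite P := Finite.of_surjective _ h.surjective

theorem exists_equiv [Finite T] (h : φ.Equitable m) {s t : T} (hst : φ s = φ t) :
    ∃ e : {r // s ⋖ r} ≃ {r // t ⋖ r}, ∀ r, φ (e r).1 = φ r.1 := by
  refine exists_equiv_children φ φ (fun r hr => ?_) fun r hr => ?_
  · rw [h.card s _ (φ.map_child hr), h.card t _ (hst ▸ φ.map_child hr)]
  · rw [h.card s _ (hst ▸ φ.map_child hr), h.card t _ (φ.map_child hr)]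

/-- Subtrees over the same vertex are isomorphic over the target. -/
theorem exists_below [Finite T] (h : φ.Equitable m) {s t : T} (hst : φ s = φ t) :
    ∃ τ : T.below s ≃o T.below t, ∀ r : T.below s, φ r.1 = φ (τ r).1 :=
  exists_orderIso_below (fun s t => φ s = φ t)
    (fun _ _ hst => by
      obtain ⟨e, he⟩ := h.exists_equiv hst
      exact ⟨e, fun r => (he r).symm⟩) hst

/-- An equitable surjective homomorphism is a tree composition. -/
theorem exists_composition [Finite T] (h : φ.Equitable m) :
    ∃ ψ : TreeComposition T P, ψ.toTreeHom = φ := by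
  refine ⟨⟨φ, h.surjective, ?_⟩, rfl⟩
  rintro s t ⟨p, hs, ht⟩ hne - - hst
  obtain ⟨e, he⟩ := h.exists_below hst
  obtain ⟨τ, hτ⟩ := exists_swap hs ht hne e
  refine ⟨τ, ?_, fun r hr => ?_⟩
  · rw [hτ ⟨s, le_rfl⟩]
    exact congrArg Subtype.val e.map_bot
  · rw [hτ ⟨r, hr⟩]
    exact he ⟨r, hr⟩

end Equitable

end TreeHom

/-! ### The tree of color sequences. -/

namespace RootedTree

/-- The tree of the color sequences along the paths from the root, for a coloring of the vertices
that distinguishes the leaves. -/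
theorem exists_quotient_tree {T : RootedTree.{u}} [Finite T] {C : Type u} (c : T → C)
    (hleaf : ∀ s t, c s = c t → IsMax s → IsMax t) :
    ∃ (P : RootedTree.{u}) (φ : TreeHom T P), Function.Surjective φ ∧
      (∀ {p q s t : T}, p ⋖ s → q ⋖ t → (φ s = φ t ↔ φ p = φ q ∧ c s = c t)) ∧
      ∀ {s t : T}, φ s = φ t → c s = c t := by
  -- `κ t` lists the colors from `t` upwards, latest first, so that ancestors correspond to
  -- suffixes. The color of the root is not recorded.
  obtain ⟨κ, h0, hs⟩ := exists_rec (T := T) ([] : List C) fun t l => c t :: l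
  have hκ : ∀ {p t : T}, p ⋖ t → κ t = c t :: κ p := by
    intro p t h
    rw [hs t (ne_bot_of_covBy h), h.pred_eq]
  have hbot : ∀ {t : T}, κ t = [] → t = ⊥ := by
    intro t h
    rcases eq_bot_or_covBy t with rfl | ⟨p, hp⟩
    · rfl
    · rw [hκ hp] at h
      exact absurd h (List.cons_ne_nil _ _)
  have hmono : ∀ {s t : T}, s ≤ t → κ s <:+ κ t := by
    intro s t hst
    refine induction_above (C := fun t => κ s <:+ κ t) (List.suffix_refl _) ?_ hst
    intro p t _ hp h
    rw [hκ hp]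
    exact h.trans (List.suffix_cons _ _)
  have hlift : ∀ (t : T) (l : List C), l <:+ κ t → ∃ s, s ≤ t ∧ κ s = l := by
    intro t
    refine induction_root (C := fun t => ∀ l : List C, l <:+ κ t → ∃ s, s ≤ t ∧ κ s = l) ?_ ?_ t
    · intro l hl
      rw [h0, List.suffix_nil] at hl
      exact ⟨⊥, le_rfl, by rw [h0, hl]⟩
    · intro p t hp ih l hl
      rw [hκ hp, List.suffix_cons_iff] at hl
      rcases hl with rfl | hl
      · exact ⟨t, le_rfl, hκ hp⟩
      · obtain ⟨s, hs, h⟩ := ih l hl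
        exact ⟨s, hs.trans hp.le, h⟩
  let _ : PartialOrder (Set.range κ) :=
    { le := fun a b => a.1 <:+ b.1
      le_refl := fun a => List.suffix_refl _
      le_trans := fun a b c => List.IsSuffix.trans
      le_antisymm := fun a b h h' =>
        Subtype.ext (h.eq_of_length (le_antisymm h.length_le h'.length_le)) }
  let _ : OrderBot (Set.range κ) :=
    { bot := ⟨κ ⊥, ⊥, rfl⟩
      bot_le := by
        rintro ⟨_, t, rfl⟩
        exact hmono bot_le }
  let P : RootedTree.{u} := ofChains (Set.range κ) fun a b c hac hbc =>
    List.suffix_or_suffix_of_suffix hac hbc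
  let k : T → Set.range κ := fun t => ⟨κ t, t, rfl⟩
  have hcov : ∀ {p t : T}, p ⋖ t → k p ⋖ k t := by
    intro p t h
    refine ⟨lt_of_le_not_ge (hmono h.le) fun hle => ?_, fun l h1 h2 => ?_⟩
    · have : κ t <:+ κ p := hle
      have := this.length_le
      rw [hκ h, List.length_cons] at this
      omega
    · have hl : l.1 <:+ κ t := h2.le
      rw [hκ h, List.suffix_cons_iff, ← hκ h] at hl
      rcases hl with hl | hl
      · exact h2.ne (Subtype.ext hl)
      · exact h1.not_ge hl
  -- If the sequence of a leaf `t` were continued by that of `s`, some `r ≤ s` would have the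
  -- sequence of `t`, hence its last color; by `hleaf` this `r` is a leaf and equals `s`.
  have hmax : ∀ {t : T}, IsMax t → IsMax (k t) := by
    rintro t ht ⟨_, s, rfl⟩ hle
    obtain ⟨r, hr, hrt⟩ := hlift s (κ t) hle
    have hrm : IsMax r := by
      rcases eq_bot_or_covBy t with rfl | ⟨p, hp⟩
      · rw [h0] at hrt
        rwa [hbot hrt]
      · rcases eq_bot_or_covBy r with rfl | ⟨q, hq⟩
        · rw [h0] at hrt
          rwa [← hbot hrt.symm]
        · rw [hκ hp, hκ hq] at hrt
          exact hleaf t r (List.cons.inj hrt).1.symm ht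
    have : r = s := hrm.eq_of_le hr
    subst this
    change κ r <:+ κ t
    rw [hrt]
  let φ : TreeHom T P := ⟨k, rfl, fun h => hcov h, fun h => hmax h⟩
  have hφ : ∀ {p q s t : T}, p ⋖ s → q ⋖ t → (φ s = φ t ↔ φ p = φ q ∧ c s = c t) := by
    intro p q s t hp hq
    change k s = k t ↔ k p = k q ∧ c s = c t
    rw [Subtype.ext_iff, Subtype.ext_iff]
    simp only [k, hκ hp, hκ hq, List.cons.injEq]
    exact and_comm
  refine ⟨P, φ, ?_, hφ, ?_⟩
  · rintro ⟨_, t, rfl⟩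
    exact ⟨t, rfl⟩
  · intro s t hst
    rcases eq_bot_or_covBy s with rfl | ⟨p, hp⟩
    · rw [φ.eq_bot (hst.symm.trans φ.map_root)]
    · rcases eq_bot_or_covBy t with rfl | ⟨q, hq⟩
      · rw [φ.eq_bot (hst.trans φ.map_root)]
      · exact ((hφ hp hq).1 hst).2

end RootedTree

/-! ### Labelings and the homomorphisms they determine. -/

namespace RootedTree

/-- A map of vertices that extends an isomorphism of subtrees. -/
theorem exists_extend {P : RootedTree.{u}} {P' : RootedTree.{v}} {x : P} {y : P'}
    (γ : P.below x ≃o P'.below y) :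
    ∃ f : P → P', (∀ t : P.below x, f t.1 = (γ t).1) ∧ f x = y ∧
      (∀ {p q}, x ≤ p → p ⋖ q → f p ⋖ f q) ∧
      (∀ {p q'}, x ≤ p → f p ⋖ q' → ∃ q, p ⋖ q ∧ f q = q') ∧
      ∀ {p q}, x ≤ p → x ≤ q → f p = f q → p = q := by
  classical
  -- The value `⊥` off the subtree carries no meaning: all properties claimed concern descendants of
  -- `x`.
  let f : P → P' := fun q => if h : x ≤ q then (γ ⟨q, h⟩).1 else ⊥
  have hf : ∀ t : P.below x, f t.1 = (γ t).1 := fun t => dif_pos t.2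
  refine ⟨f, hf, ?_, ?_, ?_, ?_⟩
  · rw [hf ⟨x, le_rfl⟩]
    exact congrArg Subtype.val γ.map_bot
  · intro p q hp hpq
    rw [hf ⟨p, hp⟩, hf ⟨q, hp.trans hpq.le⟩]
    exact TreeHom.below_covBy_iff.1 ((apply_covBy_apply_iff γ).2
      (TreeHom.below_covBy_iff (a := ⟨p, hp⟩) (b := ⟨q, hp.trans hpq.le⟩) |>.2 hpq))
  · intro p q' hp h
    rw [hf ⟨p, hp⟩] at h
    let z : P'.below y := ⟨q', (γ ⟨p, hp⟩).2.trans h.le⟩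
    refine ⟨(γ.symm z).1, ?_, ?_⟩
    · have h2 : γ ⟨p, hp⟩ ⋖ γ (γ.symm z) := by
        rw [γ.apply_symm_apply]
        exact TreeHom.below_covBy_iff.2 h
      exact TreeHom.below_covBy_iff.1 ((apply_covBy_apply_iff γ).1 h2)
    · rw [hf, γ.apply_symm_apply]
  · intro p q hp hq h
    rw [hf ⟨p, hp⟩, hf ⟨q, hq⟩] at h
    exact congrArg Subtype.val (γ.injective (Subtype.ext h))

end RootedTree

theorem IntegerPartition.ext_parts {l l' : IntegerPartition} (h : l.parts = l'.parts) :
    l = l' := by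
  obtain ⟨n, p⟩ := l
  obtain ⟨n', p'⟩ := l'
  change p.parts = p'.parts at h
  obtain rfl : n = n' := by
    apply PNat.coe_injective
    rw [← p.parts_sum, ← p'.parts_sum, h]
  rw [Nat.Partition.ext h]

namespace PartitionalLabeling

variable {Q : RootedTree.{u}}

open Classical in
/-- The parts of the label of a vertex, none for the root. -/
noncomputable def partsAt (L : PartitionalLabeling Q) (a : Q) : Multiset ℕ :=
  if h : a ≠ ⊥ then (L ⟨a, h⟩).parts else 0

theorem partsAt_eq (L : PartitionalLabeling Q) (a : {a : Q // a ≠ ⊥}) :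
    L.partsAt a.1 = (L a).parts := dif_pos a.2

theorem isomorphic_iff {Q' : RootedTree.{u}} {L : PartitionalLabeling Q}
    {M : PartitionalLabeling Q'} :
    L.Isomorphic M ↔ ∃ γ : Q ≃o Q', ∀ a, a ≠ ⊥ → L.partsAt a = M.partsAt (γ a) := by
  refine exists_congr fun γ => ⟨fun h a ha => ?_, fun h a => ?_⟩
  · rw [partsAt_eq L ⟨a, ha⟩, h ⟨a, ha⟩]
    exact (partsAt_eq M ⟨γ a, _⟩).symm
  · apply IntegerPartition.ext_parts
    rw [← partsAt_eq L, h a.1 a.2]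
    exact partsAt_eq M ⟨γ a.1, _⟩

theorem partsAt_restrict (L : PartitionalLabeling Q) (a : Q) (c : Q.below a) (hc : c ≠ ⊥) :
    (L.restrict a).partsAt c = L.partsAt c.1 := by
  rw [partsAt_eq (L.restrict a) ⟨c, hc⟩]
  exact (partsAt_eq L ⟨c.1, _⟩).symm

theorem isomorphic_restrict_iff {Q' : RootedTree.{u}} {L : PartitionalLabeling Q}
    {M : PartitionalLabeling Q'} {a : Q} {b : Q'} :
    (L.restrict a).Isomorphic (M.restrict b) ↔
      ∃ γ : Q.below a ≃o Q'.below b, ∀ c, c ≠ ⊥ → L.partsAt c.1 = M.partsAt (γ c).1 := by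
  rw [isomorphic_iff]
  refine exists_congr fun γ => forall_congr' fun c => forall_congr' fun hc => ?_
  rw [partsAt_restrict L a c hc, partsAt_restrict M b (γ c)]
  exact fun h => hc (γ.injective (h.trans γ.map_bot.symm))

end PartitionalLabeling

namespace TreeHom

open RootedTree

/-- The homomorphism `φ` is equitable with multiplicities `m`, and the parts of the label of a
child `b` of `α x` are the multiplicities of the children of `x` over `b`. -/
structure LabeledBy {T P Q : RootedTree.{u}} (φ : TreeHom T P) (m : P → ℕ) (α : TreeHom P Q)
    (L : PartitionalLabeling Q) : Prop where
  equitable : φ.Equitable m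
  surjective : Function.Surjective α
  count : ∀ (x : P) (b : Q), α x ⋖ b → ∀ k,
    (L.partsAt b).count k = {y | x ⋖ y ∧ α y = b ∧ m y = k}.ncard

/-- Vertices with isomorphic labelings carry equivalent restrictions. -/
theorem LabeledBy.equivalent {T P Q T' P' Q' : RootedTree.{u}} [Finite T] [Finite T']
    {φ : TreeHom T P} {m : P → ℕ} {α : TreeHom P Q} {L : PartitionalLabeling Q}
    {φ' : TreeHom T' P'} {m' : P' → ℕ} {α' : TreeHom P' Q'} {L' : PartitionalLabeling Q'}
    (h : φ.LabeledBy m α L) (h' : φ'.LabeledBy m' α' L') {u : T} {v : T'}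
    (hL : (L.restrict (α (φ u))).Isomorphic (L'.restrict (α' (φ' v)))) :
    (φ.restrict u).Equivalent (φ'.restrict v) := by
  have := h.equitable.finite
  have := h'.equitable.finite
  obtain ⟨γ, hγ⟩ := PartitionalLabeling.isomorphic_restrict_iff.1 hL
  obtain ⟨g, hgγ, hg0, hgc, hgs, hgi⟩ := exists_extend γ
  -- The relation matches vertices over corresponding labels with equal multiplicities. The top
  -- vertex is exempt: its multiplicity counts copies under its own parent, which the subtree does
  -- not see.
  obtain ⟨ω, hω⟩ := exists_orderIso_below (X := P) (Y := P')
    (fun x y => α (φ u) ≤ α x ∧ g (α x) = α' y ∧ (x ≠ φ u → m x = m' y)) (by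
      rintro x y ⟨hx, hxy, -⟩
      -- Both sides count how often `k` is a part of the label of `q`, respectively `g q`, and `γ`
      -- preserves labels.
      have key : ∀ q, α x ⋖ q → ∀ k,
          {t | x ⋖ t ∧ (g (α t), m t) = (g q, k)}.ncard =
            {t | y ⋖ t ∧ (α' t, m' t) = (g q, k)}.ncard := by
        intro q hq k
        have hqa : q ≠ α (φ u) := (hx.trans_lt hq.lt).ne'
        have e1 := h.count x q hq k
        have e2 := h'.count y (g q) (hxy ▸ hgc hx hq) k
        have e3 := hγ ⟨q, hx.trans hq.le⟩ fun hb => hqa (congrArg Subtype.val hb)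
        rw [← hgγ] at e3
        rw [← e3, e1] at e2
        simp only [Prod.mk.injEq]
        rw [← e2]
        congr 1
        ext t
        refine and_congr_right fun ht => and_congr_left fun _ => ⟨fun he => ?_, fun he => he ▸ rfl⟩
        exact hgi (hx.trans (α.map_child ht).le) (hx.trans hq.le) he
      obtain ⟨e, he⟩ := exists_equiv_children (fun t => (g (α t), m t)) (fun t => (α' t, m' t))
        (x := x) (y := y) (fun s hs => key _ (α.map_child hs) _) (fun s hs => by
          obtain ⟨q, hq, hqs⟩ := hgs hx (hxy ▸ α'.map_child hs)
          rw [← hqs]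
          exact key q hq _)
      refine ⟨e, fun t => ⟨hx.trans (α.map_child t.2).le, ?_, fun _ => ?_⟩⟩
      · exact (congrArg Prod.fst (he t)).symm
      · exact (congrArg Prod.snd (he t)).symm)
    (u := φ u) (v := φ' v) ⟨le_rfl, hg0, fun hn => absurd rfl hn⟩
  obtain ⟨w, hwω, hw0, hwc, hws, hwi⟩ := exists_extend ω
  -- Since `ω` preserves multiplicities away from the top, it lifts to the trees above by counting
  -- children once more.
  obtain ⟨τ, hτ⟩ := exists_orderIso_below (X := T) (Y := T')
    (fun s t => φ u ≤ φ s ∧ w (φ s) = φ' t) (by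
      rintro s t ⟨hs, hst⟩
      have key : ∀ x, φ s ⋖ x →
          {r | s ⋖ r ∧ w (φ r) = w x}.ncard = {r | t ⋖ r ∧ φ' r = w x}.ncard := by
        intro x hx
        have hux : φ u ≤ x := hs.trans hx.le
        rw [h'.equitable.card t (w x) (hst ▸ hwc hs hx)]
        have e := (hω ⟨x, hux⟩).2.2 (hs.trans_lt hx.lt).ne'
        rw [← hwω] at e
        rw [← e, ← h.equitable.card s x hx]
        congr 1
        ext r
        refine and_congr_right fun hr => ⟨fun he => ?_, fun he => he ▸ rfl⟩
        exact hwi (hs.trans (φ.map_child hr).le) hux he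
      obtain ⟨e, he⟩ := exists_equiv_children (fun r => w (φ r)) φ' (x := s) (y := t)
        (fun r hr => key _ (φ.map_child hr)) (fun r hr => by
          obtain ⟨x, hx, hxr⟩ := hws hs (hst ▸ φ'.map_child hr)
          rw [← hxr]
          exact key x hx)
      exact ⟨e, fun r => ⟨hs.trans (φ.map_child r.2).le, (he r).symm⟩⟩)
    (u := u) (v := v) ⟨le_rfl, hw0⟩
  refine ⟨τ, ω, fun t => Subtype.ext ?_⟩
  have := (hτ t).2
  rw [hwω ⟨φ t.1, φ.monotone t.2⟩] at this
  exact this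

end TreeHom

/-- Translates lists of parts into cardinalities of sets, which can be compared along injective
maps; `LabeledBy` is phrased with `count` for this reason. -/
theorem Multiset.eq_map_toFinset_iff {A : Type u} {S : Set A} (hS : S.Finite) (m : A → ℕ)
    (M : Multiset ℕ) :
    M = hS.toFinset.val.map m ↔ ∀ k, M.count k = {y | y ∈ S ∧ m y = k}.ncard := by
  classical
  have key : ∀ k, (hS.toFinset.val.map m).count k = {y | y ∈ S ∧ m y = k}.ncard := by
    intro k
    rw [Multiset.count_map, ← Finset.filter_val, Finset.card_val, ← Set.ncard_coe_finset]
    congr 1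
    ext y
    simp [eq_comm]
  rw [Multiset.ext]
  simp only [key]

theorem Set.ncard_eq_sum_fibers {A : Type u} {B : Type v} [Finite A] [Finite B] (p : A → Prop)
    (f : A → B) (S : Set B) :
    {a | p a ∧ f a ∈ S}.ncard =
      ∑ b ∈ (Set.toFinite S).toFinset, {a | p a ∧ f a = b}.ncard := by
  classical
  rw [Set.ncard_eq_toFinset_card _ (Set.toFinite _),
    Finset.card_eq_sum_card_fiberwise (f := f) (t := (Set.toFinite S).toFinset)]
  · refine Finset.sum_congr rfl fun b hb => ?_
    rw [← Set.ncard_coe_finset]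
    congr 1
    ext a
    simp only [Set.Finite.mem_toFinset] at hb
    simp only [Finset.coe_filter, Set.Finite.mem_toFinset, Set.mem_ofPred_eq]
    exact ⟨fun h => ⟨h.1.1, h.2⟩, fun h => ⟨⟨h.1, h.2 ▸ hb⟩, h.2⟩⟩
  · intro a ha
    simp only [Set.Finite.coe_toFinset, Set.mem_ofPred_eq] at ha ⊢
    exact ha.2

/-! ### Restrictions of homomorphisms and their equivalence. -/

namespace RootedTree

/-- Restriction of an isomorphism of subtrees to smaller subtrees. -/
theorem exists_restrict {P : RootedTree.{u}} {P' : RootedTree.{v}} {x : P} {y : P'}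
    (γ : P.below x ≃o P'.below y) (s : P.below x) {z : P'} (hz : (γ s).1 = z) :
    ∃ f : P.below s.1 ≃o P'.below z,
      ∀ t : P.below s.1, (f t).1 = (γ ⟨t.1, s.2.trans t.2⟩).1 := by
  subst hz
  refine ⟨{ toFun := fun t => ⟨(γ ⟨t.1, s.2.trans t.2⟩).1, γ.monotone (a := s) t.2⟩,
            invFun := fun t => ⟨(γ.symm ⟨t.1, (γ s).2.trans t.2⟩).1, ?_⟩,
            left_inv := ?_, right_inv := ?_, map_rel_iff' := ?_ }, fun t => rfl⟩
  · have : γ s ≤ ⟨t.1, (γ s).2.trans t.2⟩ := t.2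
    have := γ.symm.monotone this
    rw [γ.symm_apply_apply] at this
    exact this
  · intro t
    have h := congrArg Subtype.val (γ.symm_apply_apply ⟨t.1, s.2.trans t.2⟩)
    exact Subtype.ext h
  · intro t
    have h := congrArg Subtype.val (γ.apply_symm_apply ⟨t.1, (γ s).2.trans t.2⟩)
    exact Subtype.ext h
  · intro a b
    exact γ.le_iff_le (x := ⟨a.1, s.2.trans a.2⟩) (y := ⟨b.1, s.2.trans b.2⟩)

theorem card_below_lt {T : RootedTree.{u}} [Finite T] {s t : T} (h : s < t) :
    Nat.card (T.below t) < Nat.card (T.below s) := by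
  change Nat.card (Set.Ici t) < Nat.card (Set.Ici s)
  rw [Nat.card_coe_set_eq, Nat.card_coe_set_eq]
  exact Set.ncard_lt_ncard (Set.Ici_ssubset_Ici.2 h) (Set.toFinite _)

end RootedTree

namespace TreeHom

open RootedTree

theorem Equivalent.refl {T P : RootedTree.{u}} (φ : TreeHom T P) : φ.Equivalent φ :=
  ⟨OrderIso.refl _, OrderIso.refl _, fun _ => rfl⟩

theorem Equivalent.symm {T P T' P' : RootedTree.{u}} {φ : TreeHom T P} {φ' : TreeHom T' P'}
    (h : φ.Equivalent φ') : φ'.Equivalent φ := by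
  obtain ⟨τ, ω, h⟩ := h
  refine ⟨τ.symm, ω.symm, fun t => ?_⟩
  rw [OrderIso.symm_apply_eq, h, OrderIso.apply_symm_apply]

theorem Equivalent.trans {T P T' P' T'' P'' : RootedTree.{u}} {φ : TreeHom T P}
    {φ' : TreeHom T' P'} {φ'' : TreeHom T'' P''} (h : φ.Equivalent φ') (h' : φ'.Equivalent φ'') :
    φ.Equivalent φ'' := by
  obtain ⟨τ, ω, h⟩ := h
  obtain ⟨τ', ω', h'⟩ := h'
  exact ⟨τ.trans τ', ω.trans ω', fun t => by simp [h, h']⟩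

theorem equivalent_restrict {T P T' P' : RootedTree.{u}} {φ : TreeHom T P} {φ' : TreeHom T' P'}
    {u : T} {v : T'} (τ : T.below u ≃o T'.below v) (ω : P.below (φ u) ≃o P'.below (φ' v))
    (h : ∀ t, ω (φ.restrict u t) = φ'.restrict v (τ t)) (s : T.below u) :
    (φ.restrict s.1).Equivalent (φ'.restrict (τ s).1) := by
  obtain ⟨τ', hτ'⟩ := exists_restrict τ s rfl
  obtain ⟨ω', hω'⟩ := exists_restrict ω (φ.restrict u s) (congrArg Subtype.val (h s))
  refine ⟨τ', ω', fun t => Subtype.ext ?_⟩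
  refine (hω' _).trans ((congrArg Subtype.val (h ⟨t.1, s.2.trans t.2⟩)).trans ?_)
  exact congrArg φ' (hτ' t).symm

/-- Equivalent restrictions are related by maps of vertices that extend the isomorphisms of
subtrees. -/
theorem Equitable.exists_maps {T P T' P' : RootedTree.{u}} {φ : TreeHom T P} {φ' : TreeHom T' P'}
    {m : P → ℕ} {m' : P' → ℕ} (h : φ.Equitable m) (h' : φ'.Equitable m') {u : T} {v : T'}
    (he : (φ.restrict u).Equivalent (φ'.restrict v)) :
    ∃ (f : T → T') (w : P → P'), f u = v ∧
      (∀ {p q}, u ≤ p → p ⋖ q → f p ⋖ f q) ∧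
      (∀ {p q'}, u ≤ p → f p ⋖ q' → ∃ q, p ⋖ q ∧ f q = q') ∧
      (∀ {x y}, φ u ≤ x → x ⋖ y → w x ⋖ w y) ∧
      (∀ {x y'}, φ u ≤ x → w x ⋖ y' → ∃ y, x ⋖ y ∧ w y = y') ∧
      (∀ {x y}, φ u ≤ x → φ u ≤ y → w x = w y → x = y) ∧
      (∀ {s}, u ≤ s → w (φ s) = φ' (f s)) ∧
      (∀ {s}, u ≤ s → v ≤ f s) ∧
      (∀ {s}, u ≤ s → (φ.restrict s).Equivalent (φ'.restrict (f s))) ∧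
      ∀ {s y}, u ≤ s → φ s ⋖ y → m' (w y) = m y := by
  obtain ⟨τ, ω, hτω⟩ := he
  obtain ⟨f, hfτ, hf0, hfc, hfs, hfi⟩ := exists_extend τ
  obtain ⟨w, hwω, hw0, hwc, hws, hwi⟩ := exists_extend ω
  have hwf : ∀ {s}, u ≤ s → w (φ s) = φ' (f s) := by
    intro s hs
    rw [hfτ ⟨s, hs⟩, hwω ⟨φ s, φ.monotone hs⟩]
    exact congrArg Subtype.val (hτω ⟨s, hs⟩)
  have hvf : ∀ {s}, u ≤ s → v ≤ f s := fun {s} hs => hfτ ⟨s, hs⟩ ▸ (τ ⟨s, hs⟩).2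
  have hres : ∀ {s}, u ≤ s → (φ.restrict s).Equivalent (φ'.restrict (f s)) := by
    intro s hs
    rw [hfτ ⟨s, hs⟩]
    exact equivalent_restrict τ ω hτω ⟨s, hs⟩
  -- `f` maps the children of `s` over `y` bijectively onto the children of `f s` over `w y`.
  have hm : ∀ {s y}, u ≤ s → φ s ⋖ y → m' (w y) = m y := by
    intro s y hs hy
    have hus : φ u ≤ φ s := φ.monotone hs
    have hwy : φ' (f s) ⋖ w y := hwf hs ▸ hwc hus hy
    rw [← h.card s y hy, ← h'.card (f s) (w y) hwy]
    rw [← Set.InjOn.ncard_image (f := f) (s := {r | s ⋖ r ∧ φ r = y})]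
    · congr 1
      ext r
      constructor
      · rintro ⟨hr, hry⟩
        obtain ⟨t, ht, rfl⟩ := hfs hs hr
        refine ⟨t, ⟨ht, ?_⟩, rfl⟩
        rw [← hwf (hs.trans ht.le)] at hry
        exact hwi (hus.trans (φ.map_child ht).le) (hus.trans hy.le) hry
      · rintro ⟨t, ⟨ht, rfl⟩, rfl⟩
        exact ⟨hfc hs ht, (hwf (hs.trans ht.le)).symm⟩
    · rintro a ⟨ha, -⟩ b ⟨hb, -⟩ hab
      exact hfi (hs.trans ha.le) (hs.trans hb.le) hab
  exact ⟨f, w, hf0, hfc, hfs, hwc, hws, hwi, hwf, hvf, hres, hm⟩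

theorem Equivalent.isMax {T P T' P' : RootedTree.{u}} {φ : TreeHom T P} {φ' : TreeHom T' P'}
    {u : T} {v : T'} (h : (φ.restrict u).Equivalent (φ'.restrict v)) (hu : IsMax u) :
    IsMax v := by
  obtain ⟨τ, -, -⟩ := h
  have h1 : IsMax (⊥ : T.below u) := below_isMax_iff.2 hu
  have h2 : IsMax (τ ⊥) := (OrderIso.isMax_apply τ).2 h1
  rw [τ.map_bot] at h2
  exact below_isMax_iff.1 h2

theorem equivalent_of_isMax {T P T' P' : RootedTree.{u}} (φ : TreeHom T P) (φ' : TreeHom T' P')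
    {u : T} {v : T'} (hu : IsMax u) (hv : IsMax v) :
    (φ.restrict u).Equivalent (φ'.restrict v) := by
  have key : ∀ {X : RootedTree.{u}} {x : X}, IsMax x → ∀ s t : X.below x, s = t :=
    fun hx s t => Subtype.ext ((hx.eq_of_le s.2).symm.trans (hx.eq_of_le t.2))
  have iso : ∀ {X Y : RootedTree.{u}} {x : X} {y : Y}, IsMax x → IsMax y →
      Nonempty (X.below x ≃o Y.below y) := fun hx hy =>
    ⟨{ toFun := fun _ => ⊥, invFun := fun _ => ⊥, left_inv := fun _ => key hx _ _
       right_inv := fun _ => key hy _ _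
       map_rel_iff' := fun {a b} => ⟨fun _ => (key hx a b).le, fun _ => le_rfl⟩ }⟩
  obtain ⟨τ⟩ := iso hu hv
  obtain ⟨ω⟩ := iso (φ.map_leaf hu) (φ'.map_leaf hv)
  exact ⟨τ, ω, fun t => key (φ'.map_leaf hv) _ _⟩

/-! ### From equivalent restrictions to isomorphic labelings. -/

namespace LabeledBy

variable {T P Q T' P' Q' : RootedTree.{u}}
  {φ : TreeHom T P} {m : P → ℕ} {α : TreeHom P Q} {L : PartitionalLabeling Q}
  {φ' : TreeHom T' P'} {m' : P' → ℕ} {α' : TreeHom P' Q'} {L' : PartitionalLabeling Q'}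

theorem parts_eq [Finite P] (h : φ.LabeledBy m α L) {x : P} {b : Q} (hb : α x ⋖ b) :
    L.partsAt b = (Set.toFinite {y : P | x ⋖ y ∧ α y = b}).toFinset.val.map m := by
  rw [Multiset.eq_map_toFinset_iff]
  intro k
  rw [h.count x b hb k]
  congr 1
  ext y
  simp [and_assoc]

theorem card_parts [Finite P] (h : φ.LabeledBy m α L) {x : P} {b : Q} (hb : α x ⋖ b) :
    {y : P | x ⋖ y ∧ α y = b}.ncard = Multiset.card (L.partsAt b) := by
  rw [h.parts_eq hb, Multiset.card_map, Finset.card_val,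
    Set.ncard_eq_toFinset_card _ (Set.toFinite _)]

theorem sum_partsAt (L : PartitionalLabeling Q) {b : Q} (hb : b ≠ ⊥) :
    (L.partsAt b).sum = (L ⟨b, hb⟩).size := by
  rw [L.partsAt_eq ⟨b, hb⟩]
  exact (L ⟨b, hb⟩).2.parts_sum

variable [Finite T] [Finite T']

/-- The children of `t` over `b`, grouped by their image in `P`, form groups of size `m y`, and
these numbers are the parts of the label. -/
theorem sum_parts [Finite P] (h : φ.LabeledBy m α L) {t : T} {b : Q} (hb : α (φ t) ⋖ b) :
    {s : T | t ⋖ s ∧ α (φ s) = b}.ncard = (L.partsAt b).sum := by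
  rw [h.parts_eq hb]
  change _ = ∑ y ∈ (Set.toFinite {y : P | φ t ⋖ y ∧ α y = b}).toFinset, m y
  have := Set.ncard_eq_sum_fibers (fun s => t ⋖ s) φ {y : P | φ t ⋖ y ∧ α y = b}
  rw [show {s : T | t ⋖ s ∧ α (φ s) = b} =
    {s | t ⋖ s ∧ φ s ∈ {y : P | φ t ⋖ y ∧ α y = b}} from ?_, this]
  · refine Finset.sum_congr rfl fun y hy => h.equitable.card t y ?_
    simp only [Set.Finite.mem_toFinset] at hy
    exact hy.1
  · ext s
    exact and_congr_right fun hs => ⟨fun hb => ⟨φ.map_child hs, hb⟩, fun hb => hb.2⟩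

/-- Makes `α ∘ φ` a realization, and gives the strict equivalences demanded of a quotient. -/
theorem equitable_comp (h : φ.LabeledBy m α L) :
    (α.comp φ).Equitable fun b => (L.partsAt b).sum :=
  have := h.equitable.finite
  ⟨h.surjective.comp h.equitable.surjective, fun _ _ hb => h.sum_parts hb⟩

theorem equitable_right (h : φ.LabeledBy m α L) :
    α.Equitable fun b => Multiset.card (L.partsAt b) :=
  have := h.equitable.finite
  ⟨h.surjective, fun _ _ hb => h.card_parts hb⟩

theorem exists_child (h : φ.LabeledBy m α L) {t : T} {b : Q} (hb : α (φ t) ⋖ b) :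
    ∃ s, t ⋖ s ∧ α (φ s) = b := h.equitable_comp.exists_child hb

theorem equivalent_of_eq (h : φ.LabeledBy m α L) {s t : T} (hst : α (φ s) = α (φ t)) :
    (φ.restrict s).Equivalent (φ.restrict t) :=
  h.equivalent h (by rw [hst]; exact .refl _)

/-- Equivalent restrictions lie over isomorphic labelings if siblings below with equivalent
restrictions have the same image. -/
theorem isomorphic_of_separated (h : φ.LabeledBy m α L) (h' : φ'.LabeledBy m' α' L')
    {u : T} {v : T'}
    (hu : ∀ {s t t'}, u ≤ s → s ⋖ t → s ⋖ t' → (φ.restrict t).Equivalent (φ.restrict t') →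
      α (φ t) = α (φ t'))
    (hv : ∀ {s t t'}, v ≤ s → s ⋖ t → s ⋖ t' → (φ'.restrict t).Equivalent (φ'.restrict t') →
      α' (φ' t) = α' (φ' t'))
    (he : (φ.restrict u).Equivalent (φ'.restrict v)) :
    (L.restrict (α (φ u))).Isomorphic (L'.restrict (α' (φ' v))) := by
  have := h.equitable.finite
  have := h'.equitable.finite
  have : Finite Q := Finite.of_surjective _ h.surjective
  obtain ⟨f, w, hf0, hfc, hfs, hwc, hws, hwi, hwf, hvf, hres, hm⟩ :=
    h.equitable.exists_maps h'.equitable he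
  -- For siblings in the two subtrees, having the same image in the labeled tree now means having
  -- equivalent restrictions, a condition that `f` preserves and reflects.
  have hiff : ∀ {s t t'}, u ≤ s → s ⋖ t → s ⋖ t' →
      (α (φ t) = α (φ t') ↔ α' (φ' (f t)) = α' (φ' (f t'))) := by
    intro s t t' hs ht ht'
    have e := hres (hs.trans ht.le)
    have e' := hres (hs.trans ht'.le)
    constructor
    · intro hq
      exact hv (hvf hs) (hfc hs ht) (hfc hs ht') (e.symm.trans ((h.equivalent_of_eq hq).trans e'))
    · intro hq
      exact hu hs ht ht' (e.trans ((h'.equivalent_of_eq hq).trans e'.symm))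
  have hlab : ∀ {s t}, u ≤ s → s ⋖ t →
      L.partsAt (α (φ t)) = L'.partsAt (α' (φ' (f t))) := by
    intro s t hs ht
    have hus : φ u ≤ φ s := φ.monotone hs
    ext k
    rw [h.count (φ s) _ (α.map_child (φ.map_child ht)),
      h'.count (φ' (f s)) _ (α'.map_child (φ'.map_child (hfc hs ht))),
      ← Set.InjOn.ncard_image (f := w) (s := {y | φ s ⋖ y ∧ _ ∧ _})]
    · congr 1
      ext y
      constructor
      · rintro ⟨x, ⟨hx, hxa, hxm⟩, rfl⟩
        obtain ⟨r, hr, rfl⟩ := h.equitable.exists_child hx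
        rw [← hwf hs]
        refine ⟨hwc hus hx, ?_, (hm hs hx).trans hxm⟩
        rw [hwf (hs.trans hr.le)]
        exact (hiff hs hr ht).1 hxa
      · rintro ⟨hy, hya, hym⟩
        rw [← hwf hs] at hy
        obtain ⟨x, hx, rfl⟩ := hws hus hy
        refine ⟨x, ⟨hx, ?_, (hm hs hx).symm.trans hym⟩, rfl⟩
        obtain ⟨r, hr, rfl⟩ := h.equitable.exists_child hx
        rw [hwf (hs.trans hr.le)] at hya
        exact (hiff hs hr ht).2 hya
    · rintro a ⟨ha, -⟩ b ⟨hb, -⟩ hab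
      exact hwi (hus.trans ha.le) (hus.trans hb.le) hab
  -- Vertices of `Q` and `Q'` are related when they are the images of some `s` and of `f s`; `hiff`
  -- turns this into bijections between children.
  obtain ⟨γ, hγ⟩ := exists_orderIso_below (X := Q) (Y := Q')
    (fun a b => ∃ s, u ≤ s ∧ α (φ s) = a ∧ α' (φ' (f s)) = b ∧
      (s ≠ u → L.partsAt a = L'.partsAt b)) (by
      rintro _ _ ⟨s, hs, rfl, rfl, -⟩
      choose c hc hcα using fun a : {a // α (φ s) ⋖ a} => h.exists_child a.2
      refine ⟨Equiv.ofBijective (fun a => ⟨α' (φ' (f (c a))),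
        α'.map_child (φ'.map_child (hfc hs (hc a)))⟩) ⟨?_, ?_⟩, ?_⟩
      · intro a b hab
        have := (hiff hs (hc a) (hc b)).2 (congrArg Subtype.val hab)
        rw [hcα, hcα] at this
        exact Subtype.ext this
      · rintro ⟨b, hb⟩
        obtain ⟨r, hr, rfl⟩ := h'.exists_child hb
        obtain ⟨t, ht, rfl⟩ := hfs hs hr
        refine ⟨⟨α (φ t), α.map_child (φ.map_child ht)⟩, Subtype.ext ?_⟩
        exact (hiff hs (hc _) ht).1 (hcα _)
      · intro a
        refine ⟨c a, hs.trans (hc a).le, hcα a, rfl, fun _ => ?_⟩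
        have := hlab hs (hc a)
        rwa [hcα] at this)
    (u := α (φ u)) (v := α' (φ' v)) ⟨u, le_rfl, rfl, by rw [hf0], fun hn => absurd rfl hn⟩
  refine PartitionalLabeling.isomorphic_restrict_iff.2 ⟨γ, fun c hc => ?_⟩
  obtain ⟨s, -, hsc, -, hs⟩ := hγ c
  refine hs ?_
  rintro rfl
  exact hc (Subtype.ext hsc.symm)

end LabeledBy

end TreeHom

namespace RootedTree

/-- The subtree below the root is the whole tree. -/
def belowBot {X : RootedTree.{u}} {x : X} (hx : x = ⊥) : X.below x ≃o X where
  toFun t := t.1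
  invFun t := ⟨t, hx ▸ bot_le⟩
  left_inv _ := rfl
  right_inv _ := rfl
  map_rel_iff' := Iff.rfl

end RootedTree

theorem PartitionalLabeling.isomorphic_restrict_bot {Q : RootedTree.{u}}
    (L : PartitionalLabeling Q) {a : Q} (ha : a = ⊥) : (L.restrict a).Isomorphic L :=
  ⟨RootedTree.belowBot ha, fun _ => rfl⟩

theorem TreeHom.equivalent_restrict_bot {T P : RootedTree.{u}} (φ : TreeHom T P) :
    (φ.restrict ⊥).Equivalent φ :=
  ⟨RootedTree.belowBot rfl, RootedTree.belowBot φ.map_root, fun _ => rfl⟩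

namespace TreeHom

open RootedTree

namespace LabeledBy

variable {T P : RootedTree.{u}} [Finite T]
  {φ : TreeHom T P} {m : P → ℕ} {L : TreeOfPartitions.{u}} {α : TreeHom P L.tree}

/-- Siblings with equivalent restrictions have the same image. -/
theorem separated (h : φ.LabeledBy m α L.label) {s t t' : T} (ht : s ⋖ t) (ht' : s ⋖ t')
    (he : (φ.restrict t).Equivalent (φ.restrict t')) : α (φ t) = α (φ t') := by
  -- Induction on the size of the subtree: if the images of `t` and `t'` differed, separation of the
  -- smaller subtrees would make their labelings isomorphic, which a tree of partitions forbids.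
  induction hn : Nat.card (T.below t) using Nat.strong_induction_on generalizing s t t' with
  | _ n ih =>
  subst hn
  have hsib : Siblings (α (φ t)) (α (φ t')) :=
    ⟨_, α.map_child (φ.map_child ht), α.map_child (φ.map_child ht')⟩
  by_cases hm : IsMax t
  · exact L.leaf_unique _ _ hsib (α.map_leaf (φ.map_leaf hm))
      (α.map_leaf (φ.map_leaf (he.isMax hm)))
  have hm' : ¬ IsMax t' := fun hm' => hm (he.symm.isMax hm')
  by_contra hne
  refine L.not_isomorphic _ _ hsib hne ?_ ?_ (h.isomorphic_of_separated h ?_ ?_ he)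
  · rwa [α.isMax_iff, φ.isMax_iff]
  · rwa [α.isMax_iff, φ.isMax_iff]
  · intro r q q' hr hq hq' hqe
    exact ih _ (card_below_lt (hr.trans_lt hq.lt)) hq hq' hqe rfl
  · intro r q q' hr hq hq' hqe
    obtain ⟨τ, -, -⟩ := he
    refine ih _ ?_ hq hq' hqe rfl
    rw [Nat.card_congr τ.toEquiv]
    exact card_below_lt (hr.trans_lt hq.lt)

theorem isomorphic {T' P' : RootedTree.{u}} [Finite T']
    {φ' : TreeHom T' P'} {m' : P' → ℕ} {L' : TreeOfPartitions.{u}} {α' : TreeHom P' L'.tree}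
    (h : φ.LabeledBy m α L.label) (h' : φ'.LabeledBy m' α' L'.label) {u : T} {v : T'}
    (he : (φ.restrict u).Equivalent (φ'.restrict v)) :
    (L.label.restrict (α (φ u))).Isomorphic (L'.label.restrict (α' (φ' v))) :=
  h.isomorphic_of_separated h' (fun _ => h.separated) (fun _ => h'.separated) he

end LabeledBy

end TreeHom

/-! ### Association as a counting condition. -/

namespace TreeOfPartitions

open RootedTree TreeHom

/-- The conditions on a quotient follow from the label counts: the leaf condition from
`leaf_unique`, inequivalence of siblings from `separated`, equivalence from `equivalent_of_eq`,
strict equivalence from equitability of `α ∘ φ`. -/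
theorem isAssociated_iff {T P : RootedTree.{u}} [Finite T] [Finite P] {φ : TreeComposition T P}
    {m : P → ℕ} (hm : φ.toTreeHom.Equitable m) {L : TreeOfPartitions.{u}} :
    L.IsAssociated φ ↔ ∃ α : TreeHom P L.tree, φ.toTreeHom.LabeledBy m α L.label := by
  have hmap : ∀ (t : T) (b : L.tree) (α : P → L.tree),
      (Set.toFinite {y : P | φ t ⋖ y ∧ α y = b}).toFinset.val.map
        (fun y => {s : T | t ⋖ s ∧ φ s = y}.ncard) =
      (Set.toFinite {y : P | φ t ⋖ y ∧ α y = b}).toFinset.val.map m := by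
    intro t b α
    refine Multiset.map_congr rfl fun y hy => hm.card t y ?_
    rw [Finset.mem_val, Set.Finite.mem_toFinset] at hy
    exact hy.1
  constructor
  · rintro ⟨α, -, hα⟩
    refine ⟨α.toTreeHom, hm, α.surjective, fun x b hb k => ?_⟩
    obtain ⟨t, rfl⟩ := φ.surjective x
    have := hα t ⟨b, ne_bot_of_covBy hb⟩ hb
    rw [hmap t, ← PartitionalLabeling.partsAt_eq, Multiset.eq_map_toFinset_iff] at this
    rw [this k]
    congr 1
    ext y
    simp [and_assoc]
  · rintro ⟨α₀, h⟩
    obtain ⟨α, rfl⟩ := h.equitable_right.exists_composition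
    refine ⟨α, ⟨?_, ?_, ?_, ?_⟩, ?_⟩
    · rintro x ⟨y, hxy, hy⟩
      obtain ⟨t, rfl⟩ := φ.surjective x
      have huniq : ∀ b, α (φ t) ⋖ b → IsMax b → b = α y := fun b hb hbm =>
        L.leaf_unique _ _ ⟨_, hb, α.map_child hxy⟩ hbm (α.map_leaf hy)
      refine ⟨α y, Set.eq_singleton_iff_unique_mem.2 ⟨⟨y, ⟨hxy, hy⟩, rfl⟩, ?_⟩,
        Set.eq_singleton_iff_unique_mem.2 ⟨⟨α.map_child hxy, α.map_leaf hy⟩, ?_⟩⟩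
      · rintro _ ⟨z, ⟨hz, hzm⟩, rfl⟩
        exact huniq _ (α.map_child hz) (α.map_leaf hzm)
      · rintro b ⟨hb, hbm⟩
        exact huniq b hb hbm
    · rintro a b - hne - - s t ⟨p, hs, ht⟩ rfl rfl he
      exact hne (h.separated hs ht he)
    · intro s t _ _ hst
      exact h.equivalent_of_eq hst
    · intro s t _ _ hst
      exact h.equitable_comp.exists_below hst
    · intro t b hb
      rw [hmap t, ← PartitionalLabeling.partsAt_eq]
      exact h.parts_eq hb

theorem exists_isRealization {T P : RootedTree.{u}} [Finite T] {φ : TreeHom T P}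
    {m : P → ℕ} {L : TreeOfPartitions.{u}} {α : TreeHom P L.tree}
    (h : φ.LabeledBy m α L.label) : ∃ δ : TreeComposition T L.tree, L.IsRealization δ := by
  obtain ⟨δ, hδ⟩ := h.equitable_comp.exists_composition
  refine ⟨δ, fun t b hb => ?_⟩
  rw [← LabeledBy.sum_partsAt L.label b.2, ← h.equitable_comp.card t b.1 (hδ ▸ hb), hδ]

theorem isomorphic_of_labeledBy {T P T' P' : RootedTree.{u}} [Finite T] [Finite T']
    {φ : TreeHom T P} {m : P → ℕ} {L : TreeOfPartitions.{u}} {α : TreeHom P L.tree}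
    {φ' : TreeHom T' P'} {m' : P' → ℕ} {L' : TreeOfPartitions.{u}} {α' : TreeHom P' L'.tree}
    (h : φ.LabeledBy m α L.label) (h' : φ'.LabeledBy m' α' L'.label) (he : φ.Equivalent φ') :
    L.label.Isomorphic L'.label := by
  have := h.isomorphic h' (u := ⊥) (v := ⊥)
    ((equivalent_restrict_bot φ).trans (he.trans (equivalent_restrict_bot φ').symm))
  exact (PartitionalLabeling.isomorphic_restrict_bot _ (by rw [φ.map_root, α.map_root])).symm.trans
    (this.trans (PartitionalLabeling.isomorphic_restrict_bot _
      (by rw [φ'.map_root, α'.map_root])))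

theorem equivalent_of_isomorphic {T P T' P' : RootedTree.{u}} [Finite T] [Finite T']
    {φ : TreeHom T P} {m : P → ℕ} {L : TreeOfPartitions.{u}} {α : TreeHom P L.tree}
    {φ' : TreeHom T' P'} {m' : P' → ℕ} {L' : TreeOfPartitions.{u}} {α' : TreeHom P' L'.tree}
    (h : φ.LabeledBy m α L.label) (h' : φ'.LabeledBy m' α' L'.label)
    (hL : L.label.Isomorphic L'.label) : φ.Equivalent φ' := by
  refine (equivalent_restrict_bot φ).symm.trans (.trans ?_ (equivalent_restrict_bot φ'))
  exact h.equivalent h'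
    ((PartitionalLabeling.isomorphic_restrict_bot _ (by rw [φ.map_root, α.map_root])).trans
    (hL.trans (PartitionalLabeling.isomorphic_restrict_bot _
      (by rw [φ'.map_root, α'.map_root])).symm))

/-- Composing `α` with the isomorphism shows that being associated depends only on the isomorphism
class of the labeling. -/
theorem labeledBy_of_isomorphic {T P : RootedTree.{u}} {φ : TreeHom T P} {m : P → ℕ}
    {L L' : TreeOfPartitions.{u}} {α : TreeHom P L.tree} (h : φ.LabeledBy m α L.label)
    (hL : L.label.Isomorphic L'.label) :
    ∃ α' : TreeHom P L'.tree, φ.LabeledBy m α' L'.label := by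
  obtain ⟨γ, hγ⟩ := PartitionalLabeling.isomorphic_iff.1 hL
  refine ⟨(ofOrderIso γ).comp α, h.equitable, γ.surjective.comp h.surjective, ?_⟩
  intro x b hb k
  obtain ⟨b, rfl⟩ := γ.surjective b
  have hb' : α x ⋖ b := (apply_covBy_apply_iff γ).1 hb
  rw [← hγ b (ne_bot_of_covBy hb'), h.count x b hb' k]
  congr 1
  ext y
  exact and_congr_right fun _ => and_congr_left fun _ => γ.injective.eq_iff.symm

end TreeOfPartitions

/-! ### Cyclic families of sections and automorphisms with prescribed orbits. -/

open RootedTree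

/-- A bijection from `ZMod n` composed with reduction modulo `n = S.ncard`. -/
theorem Set.exists_int_enumeration {A : Type u} {S : Set A} (hS : 0 < S.ncard) :
    ∃ e : ℤ → A, (∀ j, e j ∈ S) ∧ (∀ i j, e i = e j ↔ (S.ncard : ℤ) ∣ j - i) ∧
      ∀ s ∈ S, ∃ j, e j = s := by
  have : NeZero S.ncard := ⟨hS.ne'⟩
  have hf : Finite S := Set.finite_of_ncard_pos hS
  obtain ⟨f⟩ : Nonempty (ZMod S.ncard ≃ S) := by
    rw [← Finite.card_eq, Nat.card_zmod, Nat.card_coe_set_eq]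
  refine ⟨fun j => (f (j : ZMod S.ncard)).1, fun j => (f _).2, fun i j => ?_, fun s hs => ?_⟩
  · rw [← ZMod.intCast_eq_intCast_iff_dvd_sub]
    exact ⟨fun h => f.injective (Subtype.ext h), fun h => congrArg (fun z => (f z).1) h⟩
  · obtain ⟨j, hj⟩ := f.surjective ⟨s, hs⟩
    obtain ⟨i, rfl⟩ := ZMod.intCast_surjective j
    exact ⟨i, congrArg Subtype.val hj⟩

namespace TreeHom

variable {T : RootedTree.{u}} {P : RootedTree.{v}} {φ : TreeHom T P} {m : P → ℕ}

/-- Sections `F k` of `φ`, for integers `k`, that run cyclically through every fiber. -/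
structure Cyclic (φ : TreeHom T P) (F : ℤ → P → T) : Prop where
  right_inverse : ∀ k y, φ (F k y) = y
  covBy : ∀ k {x y}, x ⋖ y → F k x ⋖ F k y
  period : ∀ k l y, F k y = F l y ↔ ({t | φ t = y}.ncard : ℤ) ∣ l - k
  surjective : ∀ t, ∃ k, F k (φ t) = t

theorem Cyclic.monotone {F : ℤ → P → T} (h : φ.Cyclic F) (k : ℤ) : Monotone (F k) := by
  intro x y hxy
  refine induction_above (C := fun y => F k x ≤ F k y) le_rfl ?_ hxy
  intro p t _ hpt ih
  exact ih.trans (h.covBy k hpt).le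

/-- An automorphism carrying `F` to its shift by 1 has the fibers of `φ` as its orbits. -/
theorem Cyclic.shift {F : ℤ → P → T} (h : φ.Cyclic F) (n : ℤ) :
    φ.Cyclic fun k => F (k + n) where
  right_inverse k y := h.right_inverse _ y
  covBy k := h.covBy _
  period k l y := by rw [h.period, add_sub_add_right_eq_sub]
  surjective t := by
    obtain ⟨k, hk⟩ := h.surjective t
    exact ⟨k - n, by rwa [sub_add_cancel]⟩

/-- Two cyclic families of sections differ by an automorphism. -/
theorem Cyclic.exists_orderIso {F G : ℤ → P → T} (hF : φ.Cyclic F) (hG : φ.Cyclic G) :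
    ∃ f : T ≃o T, ∀ k y, f (F k y) = G k y := by
  have key : ∀ {F G : ℤ → P → T}, φ.Cyclic F → φ.Cyclic G →
      ∃ f : T → T, Monotone f ∧ ∀ k y, f (F k y) = G k y := by
    intro F G hF hG
    -- The index of `t` is not unique, but `F` and `G` have the same period, the size of the fiber,
    -- so `G (κ t) (φ t)` does not depend on the choice.
    choose κ hκ using hF.surjective
    have hf : ∀ k y, G (κ (F k y)) (φ (F k y)) = G k y := by
      intro k y
      have := hκ (F k y)
      rw [hF.right_inverse] at this ⊢
      rwa [hG.period, ← hF.period]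
    refine ⟨fun t => G (κ t) (φ t), fun s t hst => ?_, hf⟩
    -- The section through `t` also passes through the ancestors of `t`, so one index serves both
    -- vertices.
    have hs : s = F (κ t) (φ s) := by
      refine φ.eq_of_le_of_le hst ?_ (hF.right_inverse _ _).symm
      conv_rhs => rw [← hκ t]
      exact hF.monotone _ (φ.monotone hst)
    change G (κ s) (φ s) ≤ _
    rw [hs, hf]
    exact hG.monotone _ (φ.monotone hst)
  obtain ⟨f, hf, hfF⟩ := key hF hG
  obtain ⟨g, hg, hgG⟩ := key hG hF
  have h1 : ∀ t, g (f t) = t := by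
    intro t
    obtain ⟨k, hk⟩ := hF.surjective t
    rw [← hk, hfF, hgG]
  have h2 : ∀ t, f (g t) = t := by
    intro t
    obtain ⟨k, hk⟩ := hG.surjective t
    rw [← hk, hgG, hfF]
  refine ⟨{ toFun := f, invFun := g, left_inv := h1, right_inv := h2,
            map_rel_iff' := fun {a b} => ⟨fun h => ?_, fun h => hf h⟩ }, hfF⟩
  have := hg h
  rwa [Equiv.coe_fn_mk, h1, h1] at this

theorem ncard_fiber_bot (φ : TreeHom T P) : {t | φ t = ⊥}.ncard = 1 := by
  rw [Set.ncard_eq_one]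
  refine ⟨⊥, ?_⟩
  ext t
  exact ⟨fun h => φ.eq_bot h, fun h => by rw [Set.mem_singleton_iff.1 h]; exact φ.map_root⟩

namespace Equitable

variable [Finite T]

/-- Children are chosen level by level. Moving one such section by the powers of two automorphisms
with the same orbits makes the automorphisms comparable. -/
theorem exists_section (h : φ.Equitable m) :
    ∃ s : P → T, (∀ y, φ (s y) = y) ∧ ∀ {x y}, x ⋖ y → s x ⋖ s y := by
  classical
  have := h.finite
  have hc : ∀ (t : T) (y : P), ∃ s, φ t ⋖ y → t ⋖ s ∧ φ s = y := by
    intro t y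
    by_cases hy : φ t ⋖ y
    · obtain ⟨s, hs⟩ := h.exists_child hy
      exact ⟨s, fun _ => hs⟩
    · exact ⟨⊥, fun h => absurd h hy⟩
  choose c hc using hc
  obtain ⟨s, h0, hs⟩ := exists_rec (T := P) (⊥ : T) fun y t => c t y
  have hs' : ∀ {x y}, x ⋖ y → s y = c (s x) y := by
    intro x y hxy
    rw [hs y (ne_bot_of_covBy hxy), hxy.pred_eq]
  have ho : ∀ y, φ (s y) = y := by
    intro y
    refine induction_root (C := fun y => φ (s y) = y) (by rw [h0, φ.map_root]) ?_ y
    intro x y hxy ih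
    rw [hs' hxy]
    exact (hc (s x) y (ih.symm ▸ hxy)).2
  refine ⟨s, ho, fun {x y} hxy => ?_⟩
  rw [hs' hxy]
  exact (hc (s x) y ((ho x).symm ▸ hxy)).1

/-- Group the fiber over `y` by parents: each vertex over `x` contributes `m y` children. -/
theorem ncard_fiber (h : φ.Equitable m) {x y : P} (hxy : x ⋖ y) :
    {t | φ t = y}.ncard = {t | φ t = x}.ncard * m y := by
  have := Set.ncard_eq_sum_fibers (fun t => φ t = y) (Order.pred : T → T) {s | φ s = x}
  rw [show {t | φ t = y} = {t | φ t = y ∧ Order.pred t ∈ {s | φ s = x}} from ?_, this]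
  · rw [Finset.sum_congr rfl (g := fun _ => m y), Finset.sum_const, smul_eq_mul,
      Set.ncard_eq_toFinset_card _ (Set.toFinite _)]
    intro s hs
    rw [Set.Finite.mem_toFinset] at hs
    change φ s = x at hs
    subst hs
    rw [← h.card s y hxy]
    congr 1
    ext t
    constructor
    · rintro ⟨rfl, rfl⟩
      refine ⟨pred_covBy ?_, rfl⟩
      rintro rfl
      exact ne_bot_of_covBy hxy φ.map_root
    · rintro ⟨h1, rfl⟩
      exact ⟨rfl, h1.pred_eq⟩
  · ext t
    refine ⟨fun ht => ⟨ht, ?_⟩, fun ht => ht.1⟩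
    change φ t = y at ht
    subst ht
    obtain ⟨p, hp, rfl⟩ := φ.exists_covBy hxy
    change φ (Order.pred t) = φ p
    rw [hp.pred_eq]

/-- An odometer. If `x` is the parent of `y` and `N x` is the size of the fiber over `x`, then `k`
modulo `N x` determines `F k x`, and the quotient `k / N x`, read modulo `m y`, selects one of its
children over `y`. The period becomes `N x * m y`, the size of the fiber over `y`. -/
theorem exists_cyclic (h : φ.Equitable m) : ∃ F, φ.Cyclic F := by
  classical
  have := h.finite
  have hc : ∀ (t : T) (y : P), ∃ e : ℤ → T, φ t ⋖ y →
      (∀ j, t ⋖ e j ∧ φ (e j) = y) ∧ (∀ i j, e i = e j ↔ (m y : ℤ) ∣ j - i) ∧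
        ∀ s, t ⋖ s → φ s = y → ∃ j, e j = s := by
    intro t y
    by_cases hy : φ t ⋖ y
    · have hpos := h.pos hy
      rw [← h.card t y hy] at hpos ⊢
      obtain ⟨e, h1, h2, h3⟩ := Set.exists_int_enumeration hpos
      exact ⟨e, fun _ => ⟨h1, h2, fun s hs hsy => h3 s ⟨hs, hsy⟩⟩⟩
    · exact ⟨fun _ => ⊥, fun h => absurd h hy⟩
  choose e he using hc
  let N : P → ℤ := fun y => ({t | φ t = y}.ncard : ℤ)
  obtain ⟨F, h0, hs⟩ := exists_rec (T := P) (fun _ : ℤ => (⊥ : T)) fun y f k =>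
    e (f k) y (k / N (Order.pred y))
  have hs' : ∀ {x y}, x ⋖ y → ∀ k, F y k = e (F x k) y (k / N x) := by
    intro x y hxy k
    rw [hs y (ne_bot_of_covBy hxy), hxy.pred_eq]
  have ho : ∀ y k, φ (F y k) = y := by
    intro y k
    refine induction_root (C := fun y => φ (F y k) = y) (by rw [h0, φ.map_root]) ?_ y
    intro x y hxy ih
    rw [hs' hxy]
    exact ((he (F x k) y (ih.symm ▸ hxy)).1 _).2
  have hcov : ∀ {x y}, x ⋖ y → ∀ k, F x k ⋖ F y k := by
    intro x y hxy k
    rw [hs' hxy]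
    exact ((he (F x k) y ((ho x k).symm ▸ hxy)).1 _).1
  have hN : ∀ {x y}, x ⋖ y → N y = N x * m y := by
    intro x y hxy
    simp only [N, h.ncard_fiber hxy, Nat.cast_mul]
  have hN0 : N ⊥ = 1 := by
    simp only [N, φ.ncard_fiber_bot, Nat.cast_one]
  have hNpos : ∀ x, 0 < N x := by
    intro x
    refine induction_root (C := fun x => 0 < N x) (by rw [hN0]; exact one_pos) ?_ x
    intro p t hpt ih
    rw [hN hpt]
    exact mul_pos ih (by exact_mod_cast h.pos hpt)
  have hper : ∀ y k l, F y k = F y l ↔ N y ∣ l - k := by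
    intro y
    refine induction_root (C := fun y => ∀ k l, F y k = F y l ↔ N y ∣ l - k) ?_ ?_ y
    · intro k l
      rw [h0, hN0]
      exact ⟨fun _ => one_dvd _, fun _ => rfl⟩
    · intro x y hxy ih k l
      have hpar : F y k = F y l → F x k = F x l := fun heq =>
        covBy_unique (hcov hxy k) (heq ▸ hcov hxy l)
      have hdvd : ∀ c, l - k = N x * c → (l / N x - k / N x = c) := by
        intro c hc
        have : l = k + N x * c := by linarith
        rw [this, Int.add_mul_ediv_left _ _ (hNpos x).ne']
        ring
      constructor
      · intro heq
        have hx := hpar heq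
        obtain ⟨c, hc⟩ := (ih k l).1 hx
        rw [hs' hxy, hs' hxy, hx, (he (F x l) y ((ho x l).symm ▸ hxy)).2.1, hdvd c hc] at heq
        rw [hN hxy, hc]
        exact mul_dvd_mul_left _ heq
      · rintro ⟨c, hc⟩
        rw [hN hxy, mul_assoc] at hc
        have hx := (ih k l).2 ⟨_, hc⟩
        rw [hs' hxy, hs' hxy, hx, (he (F x l) y ((ho x l).symm ▸ hxy)).2.1, hdvd _ hc]
        exact dvd_mul_right _ _
  refine ⟨fun k y => F y k, fun k y => ho y k, fun k x y hxy => hcov hxy k,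
    fun k l y => hper y k l, fun t => ?_⟩
  refine induction_root (C := fun t => ∃ k, F (φ t) k = t) ⟨0, ?_⟩ ?_ t
  · rw [φ.map_root, h0]
  · rintro p t hpt ⟨k, hk⟩
    have hxy := φ.map_child hpt
    obtain ⟨j, hj⟩ := (he p (φ t) hxy).2.2 t hpt rfl
    -- The remainder selects the parent `p`, the quotient `j` selects `t` among its children.
    refine ⟨k % N (φ p) + N (φ p) * j, ?_⟩
    have hx : F (φ p) (k % N (φ p) + N (φ p) * j) = p := by
      rw [← hk, ho]
      rw [hper]
      refine ⟨k / N (φ p) - j, ?_⟩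
      have := Int.emod_add_mul_ediv k (N (φ p))
      linear_combination -this
    have hd : (k % N (φ p) + N (φ p) * j) / N (φ p) = j := by
      rw [Int.add_mul_ediv_left _ _ (hNpos _).ne',
        Int.ediv_eq_zero_of_lt (Int.emod_nonneg _ (hNpos _).ne') (Int.emod_lt_of_pos _ (hNpos _)),
        zero_add]
    rw [hs' hxy, hx, hd, hj]

/-- The fibers of an equitable surjective homomorphism are the orbits of an automorphism. -/
theorem exists_automorphism (h : φ.Equitable m) :
    ∃ g : T ≃o T, ∀ s t, φ s = φ t ↔ orbitMk g s = orbitMk g t := by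
  obtain ⟨F, hF⟩ := h.exists_cyclic
  -- `g` sends `F k y` to `F (k + 1) y`, so it runs through the whole fiber over `y`.
  obtain ⟨g, hg⟩ := hF.exists_orderIso (hF.shift 1)
  have hpow : ∀ (n k : ℤ) y, (g ^ n) (F k y) = F (k + n) y := by
    intro n
    induction n using Int.induction_on with
    | zero => intro k y; simp
    | succ n ih =>
      intro k y
      rw [add_comm, zpow_add, RelIso.mul_apply, ih, zpow_one, hg]
      congr 1
      ring
    | pred n ih =>
      intro k y
      rw [zpow_sub_one, RelIso.mul_apply]
      have : g⁻¹ (F k y) = F (k - 1) y := by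
        have := hg (k - 1) y
        rw [sub_add_cancel] at this
        rw [← this, RelIso.inv_apply_self]
      rw [this, ih]
      congr 1
      ring
  refine ⟨g, fun s t => ?_⟩
  rw [orbitMk_eq]
  obtain ⟨k, hk⟩ := hF.surjective s
  obtain ⟨l, hl⟩ := hF.surjective t
  constructor
  · intro hst
    refine ⟨l - k, ?_⟩
    rw [← hk, hpow, ← hl, hst]
    congr 1
    ring
  · rintro ⟨n, rfl⟩
    rw [← hk, hpow, hF.right_inverse, hF.right_inverse]

end Equitable

end TreeHom

/-! ### Orbits and conjugacy. -/

section Orbits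

open TreeHom

variable {T : RootedTree.{u}} [Finite T]

/-- The minimal period of `g` at `t` is the size of its orbit; this provides the period of the
family of powers of `g` applied to a section. -/
theorem zpow_apply_eq_iff (g : T ≃o T) (k l : ℤ) (t : T) :
    (g ^ k) t = (g ^ l) t ↔ ({s | orbitMk g s = orbitMk g t}.ncard : ℤ) ∣ l - k := by
  have hset : {s | orbitMk g s = orbitMk g t} = MulAction.orbit (Subgroup.zpowers g) t := by
    ext s
    rw [Set.mem_ofPred_eq, eq_comm, orbitMk_eq]
    constructor
    · rintro ⟨n, rfl⟩
      exact ⟨⟨g ^ n, n, rfl⟩, rfl⟩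
    · rintro ⟨⟨_, n, rfl⟩, rfl⟩
      exact ⟨n, rfl⟩
  have hcard : {s | orbitMk g s = orbitMk g t}.ncard = Function.minimalPeriod (g • ·) t := by
    classical
    have := Fintype.ofFinite (MulAction.orbit (Subgroup.zpowers g) t)
    rw [hset, MulAction.minimalPeriod_eq_card, ← Nat.card_eq_fintype_card, Nat.card_coe_set_eq]
  rw [hcard, ← MulAction.zpow_smul_eq_iff_minimalPeriod_dvd]
  change _ ↔ (g ^ (l - k)) t = t
  rw [sub_eq_neg_add, zpow_add, RelIso.mul_apply, zpow_neg]
  constructor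
  · intro h
    rw [← h, RelIso.inv_apply_self]
  · intro h
    rw [← RelIso.apply_inv_self (g ^ k) ((g ^ l) t), h]

/-- A power of `g` that maps `s` to `t` maps the children of `s` in a given orbit onto the children
of `t` in that orbit. -/
theorem orbitComposition_equitable (g : T ≃o T) :
    ∃ m, (orbitComposition g).toTreeHom.Equitable m := by
  refine exists_equitable _ (orbitMk_surjective g) fun s t hst y _ => ?_
  obtain ⟨k, rfl⟩ := orbitMk_eq.1 hst
  rw [← Set.InjOn.ncard_image ((g ^ k).injective.injOn (s := {r | s ⋖ r ∧ _}))]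
  congr 1
  ext r
  constructor
  · rintro ⟨r, ⟨hr, rfl⟩, rfl⟩
    exact ⟨(apply_covBy_apply_iff (g ^ k)).2 hr, orbitMk_zpow g k r⟩
  · rintro ⟨hr, rfl⟩
    obtain ⟨r, rfl⟩ := (g ^ k).surjective r
    exact ⟨r, ⟨(apply_covBy_apply_iff (g ^ k)).1 hr, (orbitMk_zpow g k r).symm⟩, rfl⟩

theorem cyclic_of_orbits {P : RootedTree.{v}} {φ : TreeHom T P} {s : P → T}
    (hs : ∀ y, φ (s y) = y) (hs' : ∀ {x y}, x ⋖ y → s x ⋖ s y) (g : T ≃o T)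
    (hg : ∀ s t, φ s = φ t ↔ orbitMk g s = orbitMk g t) :
    φ.Cyclic fun k y => (g ^ k) (s y) where
  right_inverse k y := by
    conv_rhs => rw [← hs y]
    rw [hg, orbitMk_zpow]
  covBy k x y hxy := (apply_covBy_apply_iff (g ^ k)).2 (hs' hxy)
  period k l y := by
    rw [zpow_apply_eq_iff]
    simp only [← hg, hs]
  surjective t := by
    have := (hg (s (φ t)) t).1 (hs _)
    exact orbitMk_eq.1 this

/-- Automorphisms with the same orbits are conjugate. -/
theorem isConj_of_orbits {g h : T ≃o T}
    (hgh : ∀ s t, orbitMk g s = orbitMk g t ↔ orbitMk h s = orbitMk h t) : IsConj g h := by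
  obtain ⟨m, hm⟩ := orbitComposition_equitable g
  obtain ⟨s, hs, hs'⟩ := hm.exists_section
  have hF := cyclic_of_orbits hs hs' g fun _ _ => Iff.rfl
  have hG := cyclic_of_orbits hs hs' h hgh
  -- `f` sends `(g ^ k) (s y)` to `(h ^ k) (s y)` for all `k`. Passing from `k` to `k + 1` gives `f
  -- * g = h * f`.
  obtain ⟨f, hf⟩ := hF.exists_orderIso hG
  refine isConj_iff.2 ⟨f, ?_⟩
  rw [mul_inv_eq_iff_eq_mul]
  refine DFunLike.ext _ _ fun t => ?_
  obtain ⟨k, hk⟩ := hF.surjective t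
  rw [RelIso.mul_apply, RelIso.mul_apply, ← hk]
  have h1 := hf (k + 1) ((orbitComposition g).toTreeHom t)
  rw [add_comm, zpow_add, zpow_add, RelIso.mul_apply, RelIso.mul_apply, zpow_one, zpow_one,
    ← hf k] at h1
  exact h1

end Orbits

/-! ### The tree of partitions of an equitable map. -/

open RootedTree TreeHom

/-- Equal parts of a partition are told apart by their positions in a list, which serve as names of
blocks. -/
theorem List.count_eq_ncard (l : List ℕ) (k : ℕ) : l.count k = {i : ℕ | l[i]? = some k}.ncard := by
  have hfin : ∀ l : List ℕ, {i : ℕ | l[i]? = some k}.Finite := by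
    intro l
    refine (Set.finite_lt_nat l.length).subset fun i hi => ?_
    exact (List.getElem?_eq_some_iff.1 hi).1
  induction l with
  | nil => simp
  | cons a l ih =>
    have hsucc : (Nat.succ '' {i : ℕ | l[i]? = some k}).ncard = l.count k := by
      rw [Set.ncard_image_of_injective _ Nat.succ_injective, ih]
    by_cases ha : a = k
    · have : {i : ℕ | (a :: l)[i]? = some k} = insert 0 (Nat.succ '' {i : ℕ | l[i]? = some k}) := by
        ext i
        cases i <;> simp [ha]
      rw [this, Set.ncard_insert_of_notMem (by simp) ((hfin l).image _), hsucc, ha,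
        List.count_cons_self]
    · have : {i : ℕ | (a :: l)[i]? = some k} = Nat.succ '' {i : ℕ | l[i]? = some k} := by
        ext i
        cases i <;> simp [ha]
      rw [this, hsucc, List.count_cons_of_ne ha]

/-- Elements of `S` receive the number of their block. The default 0 says that no element has a
number beyond the list. -/
theorem Set.exists_blocks {A : Type u} {S : Set A} (hS : S.Finite) (l : List ℕ)
    (h : S.ncard = l.sum) : ∃ f : A → ℕ, ∀ i, {a | a ∈ S ∧ f a = i}.ncard = l.getD i 0 := by
  classical
  induction l generalizing S with
  | nil =>
    have hS' : S = ∅ := (Set.ncard_eq_zero hS).1 h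
    exact ⟨fun _ => 0, fun i => by simp [hS']⟩
  | cons n l ih =>
    rw [List.sum_cons] at h
    obtain ⟨S₁, h₁, hn⟩ := Set.exists_subset_card_eq (s := S) (n := n) (by omega)
    obtain ⟨f, hf⟩ := ih (hS.subset Set.sdiff_subset) (S := S \ S₁) (by
      rw [Set.ncard_sdiff h₁ (hS.subset h₁)]
      omega)
    refine ⟨fun a => if a ∈ S₁ then 0 else f a + 1, fun i => ?_⟩
    cases i with
    | zero =>
      rw [List.getD_cons_zero, ← hn]
      congr 1
      ext a
      by_cases ha : a ∈ S₁
      · simp [ha, h₁ ha]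
      · simp [ha]
    | succ i =>
      rw [List.getD_cons_succ, ← hf i]
      congr 1
      ext a
      by_cases ha : a ∈ S₁ <;> simp [ha]

namespace TreeHom

variable {T P : RootedTree.{u}} [Finite T] {φ : TreeHom T P} {m : P → ℕ}

theorem Equitable.equivalent_of_eq (h : φ.Equitable m) {s t : T} (hst : φ s = φ t) :
    (φ.restrict s).Equivalent (φ.restrict t) := by
  obtain ⟨τ, hτ⟩ := h.exists_below hst
  obtain ⟨ω, hω⟩ : ∃ ω : P.below (φ s) ≃o P.below (φ t), ∀ x, (ω x).1 = x.1 := by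
    rw [hst]
    exact ⟨OrderIso.refl _, fun _ => rfl⟩
  exact ⟨τ, ω, fun r => Subtype.ext ((hω _).trans (hτ r))⟩

/-- Every equitable surjective homomorphism has a tree of partitions. -/
theorem Equitable.exists_treeOfPartitions (h : φ.Equitable m) :
    ∃ (L : TreeOfPartitions.{u}) (α : TreeHom P L.tree), φ.LabeledBy m α L.label := by
  classical
  have := h.finite
  let r : Setoid T :=
    { r := fun s t => (φ.restrict s).Equivalent (φ.restrict t)
      iseqv := ⟨fun s => .refl _, .symm, .trans⟩ }
  -- Vertices are colored by the equivalence class of their restriction, so siblings are identified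
  -- exactly when their restrictions are equivalent.
  obtain ⟨Q, δ, hδ, hδs, hδc⟩ := exists_quotient_tree (Quotient.mk r)
    fun s t hst => Equivalent.isMax (Quotient.exact hst)
  have hδe : ∀ {s t}, δ s = δ t → (φ.restrict s).Equivalent (φ.restrict t) :=
    fun hst => Quotient.exact (hδc hst)
  have hδi : ∀ {p q s t}, p ⋖ s → q ⋖ t → δ p = δ q →
      (φ.restrict s).Equivalent (φ.restrict t) → δ s = δ t :=
    fun hs ht hpq he => (hδs hs ht).2 ⟨hpq, Quotient.sound he⟩
  have hφδ : ∀ s t, φ s = φ t → δ s = δ t := by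
    intro s
    refine induction_root (C := fun s => ∀ t, φ s = φ t → δ s = δ t) ?_ ?_ s
    · intro t ht
      rw [φ.eq_bot (ht.symm.trans φ.map_root)]
    · intro p s hp ih t hst
      obtain ⟨q, hq, hqp⟩ := φ.exists_covBy (hst ▸ φ.map_child hp)
      exact hδi hp hq (ih q hqp.symm) (h.equivalent_of_eq hst)
  obtain ⟨α, hα⟩ := φ.exists_factor h.surjective δ hφδ
  -- The label of `b` may be read off at any vertex over its parent: an equivalence between two such
  -- vertices preserves multiplicities and, by `hδi`, images in `Q`.
  have hcount : ∀ {s t} (b : Q) (k : ℕ), δ s = δ t →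
      {y | φ s ⋖ y ∧ α y = b ∧ m y = k}.ncard = {y | φ t ⋖ y ∧ α y = b ∧ m y = k}.ncard := by
    intro s t b k hst
    obtain ⟨f, w, hf0, hfc, hfs, hwc, hws, hwi, hwf, -, hres, hm⟩ := h.exists_maps h (hδe hst)
    have hαw : ∀ {y}, φ s ⋖ y → α (w y) = α y := by
      intro y hy
      obtain ⟨r, hr, rfl⟩ := h.exists_child hy
      rw [hwf hr.le, hα, hα]
      exact hδi (hfc le_rfl hr) hr (by rw [hf0, hst]) (hres hr.le).symm
    have hw0 : w (φ s) = φ t := by rw [hwf le_rfl, hf0]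
    rw [← Set.InjOn.ncard_image (f := w) (s := {y | φ s ⋖ y ∧ _ ∧ _})]
    · congr 1
      ext z
      constructor
      · rintro ⟨y, ⟨hy, hyb, hyk⟩, rfl⟩
        exact ⟨hw0 ▸ hwc le_rfl hy, (hαw hy).trans hyb, (hm le_rfl hy).trans hyk⟩
      · rintro ⟨hz, hzb, hzk⟩
        rw [← hw0] at hz
        obtain ⟨y, hy, rfl⟩ := hws le_rfl hz
        exact ⟨y, ⟨hy, (hαw hy).symm.trans hzb, (hm le_rfl hy).symm.trans hzk⟩, rfl⟩
    · rintro y ⟨hy, -⟩ z ⟨hz, -⟩ hyz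
      exact hwi hy.le hz.le hyz
  have hlabel : ∀ b : {b : Q // b ≠ ⊥}, ∃ l : IntegerPartition, ∀ t, δ t ⋖ b.1 → ∀ k,
      l.parts.count k = {y | φ t ⋖ y ∧ α y = b.1 ∧ m y = k}.ncard := by
    rintro ⟨b, hb⟩
    obtain ⟨t, rfl⟩ := hδ b
    rcases eq_bot_or_covBy t with rfl | ⟨p, hp⟩
    · exact absurd δ.map_root hb
    have hfin := Set.toFinite {y | φ p ⋖ y ∧ α y = δ t}
    have hmem : φ t ∈ hfin.toFinset := by
      rw [Set.Finite.mem_toFinset]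
      exact ⟨φ.map_child hp, hα t⟩
    have hpos : ∀ i ∈ hfin.toFinset.val.map m, 0 < i := by
      intro i hi
      obtain ⟨y, hy, rfl⟩ := Multiset.mem_map.1 hi
      rw [Finset.mem_val, Set.Finite.mem_toFinset] at hy
      exact h.pos hy.1
    have hsum : 0 < (hfin.toFinset.val.map m).sum :=
      (h.pos (φ.map_child hp)).trans_le
        (Multiset.le_sum_of_mem (Multiset.mem_map_of_mem m hmem))
    refine ⟨⟨⟨_, hsum⟩, ⟨hfin.toFinset.val.map m, fun {i} hi => hpos i hi, rfl⟩⟩,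
      fun q hq k => ?_⟩
    rw [← hcount (δ t) k (covBy_unique (δ.map_child hp) hq)]
    refine ((Multiset.eq_map_toFinset_iff hfin m _).1 rfl k).trans ?_
    congr 1
    ext y
    simp [and_assoc]
  choose l hl using hlabel
  have hL : φ.LabeledBy m α l := by
    refine ⟨h, fun b => ?_, fun x b hb k => ?_⟩
    · obtain ⟨t, rfl⟩ := hδ b
      exact ⟨φ t, hα t⟩
    · obtain ⟨t, rfl⟩ := h.surjective x
      rw [PartitionalLabeling.partsAt_eq l ⟨b, ne_bot_of_covBy hb⟩]
      exact hl _ t (hα t ▸ hb) k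
  have hsib : ∀ a b : Q, Siblings a b → ∃ p s t, p ⋖ s ∧ p ⋖ t ∧ δ s = a ∧ δ t = b := by
    rintro a b ⟨p, ha, hb⟩
    obtain ⟨p, rfl⟩ := hδ p
    rw [← hα] at ha hb
    obtain ⟨s, hs, rfl⟩ := hL.exists_child ha
    obtain ⟨t, ht, rfl⟩ := hL.exists_child hb
    exact ⟨p, s, t, hs, ht, (hα s).symm, (hα t).symm⟩
  refine ⟨⟨Q, Finite.of_surjective _ hδ, l, ?_, ?_⟩, α, hL⟩
  · intro a b hab ha hb
    obtain ⟨p, s, t, hs, ht, rfl, rfl⟩ := hsib a b hab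
    exact hδi hs ht rfl (equivalent_of_isMax φ φ (δ.isMax_iff.1 ha) (δ.isMax_iff.1 hb))
  · intro a b hab hne _ _ hiso
    obtain ⟨p, s, t, hs, ht, rfl, rfl⟩ := hsib a b hab
    rw [← hα, ← hα] at hiso
    -- Isomorphic labelings would give equivalent restrictions, hence equal colors.
    exact hne (hδi hs ht rfl (hL.equivalent hL hiso))

end TreeHom

/-! ### From realizations to equitable maps. -/

namespace TreeOfPartitions

/-- A realization of a tree of partitions factors through a homomorphism whose multiplicities are
the parts of the labels. -/
theorem IsRealization.exists_labeledBy {T : RootedTree.{u}} [Finite T] {L : TreeOfPartitions.{u}}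
    {δ : TreeComposition T L.tree} (hδ : L.IsRealization δ) :
    ∃ (P : RootedTree.{u}) (φ : TreeHom T P) (m : P → ℕ) (α : TreeHom P L.tree),
      φ.LabeledBy m α L.label := by
  classical
  have hcard : ∀ (t : T) (b : L.tree), δ t ⋖ b →
      {s | t ⋖ s ∧ δ s = b}.ncard = (L.label.partsAt b).toList.sum := by
    intro t b hb
    rw [← hδ t ⟨b, ne_bot_of_covBy hb⟩ hb, Multiset.sum_toList]
    exact (LabeledBy.sum_partsAt L.label (ne_bot_of_covBy hb)).symm
  have hblock : ∀ (t : T) (b : L.tree), ∃ f : T → ℕ, δ t ⋖ b → ∀ i,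
      {s | s ∈ {s | t ⋖ s ∧ δ s = b} ∧ f s = i}.ncard = (L.label.partsAt b).toList.getD i 0 := by
    intro t b
    by_cases hb : δ t ⋖ b
    · obtain ⟨f, hf⟩ := Set.exists_blocks (Set.toFinite _) _ (hcard t b hb)
      exact ⟨f, fun _ => hf⟩
    · exact ⟨fun _ => 0, fun h => absurd h hb⟩
  choose f hf using hblock
  -- The block of `t` among its siblings over `δ t`, that is, a position in the list of parts of the
  -- label of `δ t`.
  let ℓ : T → ℕ := fun t => f (Order.pred t) (δ t) t
  have hℓ : ∀ {t : T} {b : L.tree}, δ t ⋖ b → ∀ i,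
      {s | t ⋖ s ∧ δ s = b ∧ ℓ s = i}.ncard = (L.label.partsAt b).toList.getD i 0 := by
    intro t b hb i
    rw [← hf t b hb i]
    congr 1
    ext s
    constructor
    · rintro ⟨hs, rfl, hi⟩
      exact ⟨⟨hs, rfl⟩, by rw [← hi]; simp only [ℓ, hs.pred_eq]⟩
    · rintro ⟨⟨hs, rfl⟩, hi⟩
      exact ⟨hs, rfl, by rw [← hi]; simp only [ℓ, hs.pred_eq]⟩
  obtain ⟨P, φ, hφ, hφs, hφc⟩ := exists_quotient_tree (fun t => (δ t, ℓ t)) (by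
    intro s t hst hs
    have h1 : δ.toTreeHom s = δ.toTreeHom t := congrArg Prod.fst hst
    exact δ.toTreeHom.isMax_iff.1 (h1 ▸ δ.map_leaf hs))
  have hφδ : ∀ s t, φ s = φ t → δ s = δ t := fun s t hst => congrArg Prod.fst (hφc hst)
  have hset : ∀ {s p t : T}, φ s = φ p → p ⋖ t →
      {r | s ⋖ r ∧ φ r = φ t} = {r | s ⋖ r ∧ δ r = δ t ∧ ℓ r = ℓ t} := by
    intro s p t hsp ht
    ext r
    refine and_congr_right fun hr => ?_
    rw [hφs hr ht, Prod.mk.injEq]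
    exact and_iff_right hsp
  have hmult : ∀ {s p t : T}, φ s = φ p → p ⋖ t → {r | s ⋖ r ∧ φ r = φ t}.ncard =
      (L.label.partsAt (δ t)).toList.getD (ℓ t) 0 := by
    intro s p t hsp ht
    rw [hset hsp ht]
    exact hℓ (hφδ _ _ hsp ▸ δ.map_child ht) _
  obtain ⟨m, hm⟩ := φ.exists_equitable hφ (by
    intro s t hst y hy
    obtain ⟨r, rfl⟩ := hφ y
    obtain ⟨p, hp, hpt⟩ := φ.exists_covBy hy
    rw [hmult (hst.trans hpt.symm) hp, hmult hpt.symm hp])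
  have hm' : ∀ {p t : T}, p ⋖ t → m (φ t) = (L.label.partsAt (δ t)).toList.getD (ℓ t) 0 := by
    intro p t ht
    rw [← hm.card p _ (φ.map_child ht), hmult rfl ht]
  obtain ⟨α, hα⟩ := φ.exists_factor hφ δ.toTreeHom hφδ
  refine ⟨P, φ, m, α, hm, fun b => ?_, fun x b hb k => ?_⟩
  · obtain ⟨t, rfl⟩ := δ.surjective b
    exact ⟨φ t, hα t⟩
  obtain ⟨t, rfl⟩ := hφ x
  have hb' : δ t ⋖ b := hα t ▸ hb
  -- Parts are positive, so every listed position has a nonempty block, and a positive block size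
  -- cannot be the default 0.
  have hpos : ∀ i ∈ L.label.partsAt b, 0 < i := by
    intro i hi
    rw [L.label.partsAt_eq ⟨b, ne_bot_of_covBy hb⟩] at hi
    exact (L.label _).2.parts_pos hi
  have hmem : ∀ {i k}, (L.label.partsAt b).toList[i]? = some k → 0 < k := fun hi =>
    hpos _ (Multiset.mem_toList.1 (List.mem_of_getElem? hi))
  have hc : ∀ i, ∃ s, ∀ k, (L.label.partsAt b).toList[i]? = some k →
      t ⋖ s ∧ δ s = b ∧ ℓ s = i := by
    intro i
    by_cases hi : ∃ k, (L.label.partsAt b).toList[i]? = some k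
    · obtain ⟨k, hk⟩ := hi
      have h1 := hℓ hb' i
      rw [List.getD_eq_getElem?_getD, hk] at h1
      have : 0 < {s | t ⋖ s ∧ δ s = b ∧ ℓ s = i}.ncard := h1 ▸ hmem hk
      obtain ⟨s, hs⟩ := (Set.ncard_pos (Set.toFinite _)).1 this
      exact ⟨s, fun _ _ => hs⟩
    · exact ⟨⊥, fun k hk => absurd ⟨k, hk⟩ hi⟩
  -- `c i` is a child of `t` in block `i`; sending `i` to `φ (c i)` matches the positions of the
  -- part `k` with the children of `φ t` over `b` of multiplicity `k`.
  choose c hc using hc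
  rw [← Multiset.coe_toList (L.label.partsAt b), Multiset.coe_count, List.count_eq_ncard, ← Set.InjOn.ncard_image (f := fun i => φ (c i))]
  · congr 1
    ext y
    constructor
    · rintro ⟨i, hi, rfl⟩
      obtain ⟨h1, h2, h3⟩ := hc i k hi
      refine ⟨φ.map_child h1, (hα _).trans h2, ?_⟩
      have hi' : (L.label.partsAt b).toList[i]? = some k := hi
      rw [hm' h1, h2, h3, List.getD_eq_getElem?_getD, hi', Option.getD_some]
    · rintro ⟨hy, hyb, hyk⟩
      obtain ⟨s, hs, rfl⟩ := hm.exists_child hy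
      have hk : 0 < k := hyk ▸ hm.pos hy
      have hsb : δ s = b := (hα s).symm.trans hyb
      rw [hm' hs, hsb, List.getD_eq_getElem?_getD] at hyk
      have hi : (L.label.partsAt b).toList[ℓ s]? = some k := by
        cases ho : (L.label.partsAt b).toList[ℓ s]? with
        | none => rw [ho, Option.getD_none] at hyk; omega
        | some j => rw [ho, Option.getD_some] at hyk; rw [hyk]
      obtain ⟨h1, h2, h3⟩ := hc _ k hi
      exact ⟨ℓ s, hi, (hφs h1 hs).2 ⟨rfl, Prod.ext (h2.trans hsb.symm) h3⟩⟩
  · intro i hi j hj hij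
    have := congrArg Prod.snd (hφc hij)
    exact (hc i k hi).2.2.symm.trans (this.trans (hc j k hj).2.2)

end TreeOfPartitions

/-! ### Conjugacy classes and the bijection. -/

section Conjugacy

variable {T : RootedTree.{u}}

theorem orbitMk_conj (g c : T ≃o T) (s t : T) :
    orbitMk (c * g * c⁻¹) (c s) = orbitMk (c * g * c⁻¹) (c t) ↔ orbitMk g s = orbitMk g t := by
  rw [orbitMk_eq, orbitMk_eq]
  refine exists_congr fun k => ?_
  rw [conj_zpow, RelIso.mul_apply, RelIso.mul_apply, RelIso.inv_apply_self]
  exact c.injective.eq_iff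

variable [Finite T]

/-- An equivalence is an automorphism `c` of `T` followed by relabeling the target: the fibers of
`ψ` are the preimages under `c` of the `g`-orbits, which are the orbits of `c⁻¹ * g * c`. -/
theorem equivalent_orbitComposition_iff (g : T ≃o T) (P : RootedTree.{u})
    (ψ : TreeComposition T P) :
    ψ.Equivalent (orbitComposition g).toTreeHom ↔
      ∃ g' : T ≃o T, IsConj g g' ∧ ψ.Isomorphic (orbitComposition g').toTreeHom := by
  constructor
  · rintro ⟨τ, ω, h⟩
    let c : T ≃o T := τ
    refine ⟨c⁻¹ * g * c⁻¹⁻¹, isConj_iff.2 ⟨c⁻¹, rfl⟩, ?_⟩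
    refine ψ.toTreeHom.exists_orderIso ψ.surjective _ (orbitMk_surjective _) fun s t => ?_
    have key := orbitMk_conj g c⁻¹ (c s) (c t)
    rw [RelIso.inv_apply_self, RelIso.inv_apply_self] at key
    refine Iff.trans ?_ key.symm
    rw [← ω.injective.eq_iff, h, h]
    rfl
  · rintro ⟨g', hg, ω, hω⟩
    obtain ⟨c, rfl⟩ := isConj_iff.1 hg
    obtain ⟨ω', hω'⟩ := (orbitComposition g).toTreeHom.exists_orderIso (orbitMk_surjective g)
      ((orbitComposition (c * g * c⁻¹)).toTreeHom.comp (ofOrderIso c))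
      ((orbitMk_surjective _).comp c.surjective) fun s t => (orbitMk_conj g c s t).symm
    have : (orbitComposition g).toTreeHom.Equivalent ψ.toTreeHom :=
      ⟨c, ω'.trans ω.symm, fun t => by
        rw [OrderIso.trans_apply, hω', OrderIso.symm_apply_eq, hω]
        rfl⟩
    exact this.symm

/-- If the orbit maps are equivalent, the orbits of `g` are those of a conjugate of `h`, and
`isConj_of_orbits` applies. -/
theorem isConj_iff_equivalent (g h : T ≃o T) :
    IsConj g h ↔ (orbitComposition g).toTreeHom.Equivalent (orbitComposition h).toTreeHom := by
  constructor
  · intro hgh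
    exact (equivalent_orbitComposition_iff h _ (orbitComposition g)).2
      ⟨g, hgh.symm, OrderIso.refl _, fun _ => rfl⟩
  · intro he
    obtain ⟨g', hg', ω, hω⟩ := (equivalent_orbitComposition_iff h _ (orbitComposition g)).1 he
    refine (isConj_of_orbits fun s t => ?_).trans hg'.symm
    change (orbitComposition g).toTreeHom s = (orbitComposition g).toTreeHom t ↔
      (orbitComposition g').toTreeHom s = (orbitComposition g').toTreeHom t
    rw [← hω, ← hω, ω.injective.eq_iff]

end Conjugacy

theorem mainTheorem4 (T : RootedTree.{u}) [Finite T] :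
    (∀ (g : T ≃o T) (P : RootedTree.{u}) (ψ : TreeComposition T P),
      ψ.Equivalent (orbitComposition g).toTreeHom ↔
        ∃ g' : T ≃o T, IsConj g g' ∧ ψ.Isomorphic (orbitComposition g').toTreeHom) ∧
    ∃ F : ConjClasses (T ≃o T) ≃ Par T,
      ∀ (g : T ≃o T) (L : TreeOfPartitions.{u}),
        (F (ConjClasses.mk g) : Quotient TreeOfPartitions.setoid.{u}) = Quotient.mk _ L ↔
          L.IsAssociated (orbitComposition g) := by
  refine ⟨equivalent_orbitComposition_iff, ?_⟩
  choose m hm using orbitComposition_equitable (T := T)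
  choose L α h using fun g => (hm g).exists_treeOfPartitions
  let G : (T ≃o T) → Par T := fun g => ⟨Quotient.mk _ (L g), L g, rfl,
    TreeOfPartitions.exists_isRealization (h g)⟩
  -- One direction makes `G` descend to conjugacy classes, the other makes the descended map
  -- injective.
  have hG : ∀ g g', G g = G g' ↔ IsConj g g' := by
    intro g g'
    rw [isConj_iff_equivalent, Subtype.ext_iff]
    refine Quotient.eq.trans ⟨fun hL => ?_, fun he => ?_⟩
    · exact TreeOfPartitions.equivalent_of_isomorphic (h g) (h g') hL
    · exact TreeOfPartitions.isomorphic_of_labeledBy (h g) (h g') he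
  let F : ConjClasses (T ≃o T) → Par T := Quotient.lift G fun g g' hgg' => (hG g g').2 hgg'
  have hF : Function.Bijective F := by
    constructor
    · intro a b
      induction a using Quotient.inductionOn
      induction b using Quotient.inductionOn
      intro hab
      exact Quotient.sound ((hG _ _).1 hab)
    · rintro ⟨_, L', rfl, δ, hδ⟩
      -- The realization is refined to an equitable map, whose fibers are the orbits of some `g`;
      -- the tree of `g` is then isomorphic to `L'`.
      obtain ⟨P, φ, m', α', h'⟩ := hδ.exists_labeledBy
      obtain ⟨g, hg⟩ := h'.equitable.exists_automorphism
      obtain ⟨ω, hω⟩ := φ.exists_orderIso h'.equitable.surjective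
        (orbitComposition g).toTreeHom (orbitMk_surjective g) hg
      have he : φ.Equivalent (orbitComposition g).toTreeHom := ⟨OrderIso.refl _, ω, hω⟩
      exact ⟨ConjClasses.mk g, Subtype.ext (Quotient.sound
        (TreeOfPartitions.isomorphic_of_labeledBy (h g) h' he.symm))⟩
  refine ⟨Equiv.ofBijective F hF, fun g L' => ?_⟩
  rw [TreeOfPartitions.isAssociated_iff (hm g)]
  refine Quotient.eq.trans ⟨fun hL => ?_, fun ⟨α', h'⟩ => ?_⟩
  · exact TreeOfPartitions.labeledBy_of_isomorphic (h g) hL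
  · exact TreeOfPartitions.isomorphic_of_labeledBy (h g) h' (.refl _)
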